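/- Let $G$ be a finite simple connected graph of order $n$ and diameter $2$. For a set $W$ of vertices, the representation of a vertex $v$ with respect to $W$ is the vector of distances $(d(v,w))_{w\in W}$; $W$ is resolving if distinct vertices of $G$ have distinct representations, and the metric dimension $\beta(G)$ is the minimum size of a resolving set. Two distinct vertices $u,v$ are twins if $N(u)\setminus\{v\}=N(v)\setminus\{u\}$; "equal or twins" is an equivalence relation, and $v^*$ denotes the class of $v$. The twin graph $G^*$ has the classes as vertices, distinct classes $u^*,v^*$ being adjacent if and only if $uv\in E(G)$. A class $v^*$ is of type (1) if $|v^*|=1$, of type (K) if $|v^*|\ge 2$ and $v^*$ induces a complete graph, and of type (N) if $|v^*|\ge 2$ and $v^*$ induces an edgeless graph; type (1K) means (1) or (K), type (1N) means (1) or (N), type (KN) means (K) or (N), and any type means no restriction. (The paw is a triangle with a pendant edge; the kite is $K_4$ minus an edge; two chords are adjacent if they share an end; $\vee$ is the join.) Then $\beta(G)=n-3$ if and only if $G^*$ with the types of its vertices has one of the following structures: - $G_1$: $G^*\cong K_3$, and at most one vertex is of type (1K). - $G_2$: $G^*\cong P_3$, and either (a) the degree-$2$ vertex is of type (N), one leaf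 is of type (K) and the other is of any type; or (b) one leaf is of type (K), the other is of type (KN), and the degree-$2$ vertex is of any type. - $G_3$: $G^*$ is the paw; the degree-$3$ vertex is of any type, one degree-$2$ vertex is of type (N), the other is of type (1K), and the leaf is of type (1N); moreover, if a degree-$2$ vertex is of type (K), then neither the leaf nor the degree-$3$ vertex is of type (N). - $G_4$: $G^*\cong C_5$, and every vertex is of type (1). - $G_5$: $G^*$ is $C_5$ with one chord; the two adjacent degree-$2$ vertices are of type (1), and the other three vertices are of type (1K). - $G_6$: $G^*$ is $C_5$ with two adjacent chords; the degree-$4$ vertex is of any type, the others are of type (1K); moreover, no two distinct non-adjacent vertices are both of type (K), and no vertex of type (K) is adjacent to a vertex of type (N). - $G_7$: $G^*$ is the kite with a pendant edge attached to a degree-$3$ vertex of the kite; the leaf is of type (1), the degree-$4$ vertex and the degree-$3$ vertex are of type (1K), one degree-$2$ vertex is of type (K), and the other is of type (1). - $G_8$: $G^*$ is the kite; one degree-$2$ vertex is of type (K) and the other of type (1), one degree-$3$ vertex is of type (N) and the other of type (1K). - $G_9$: $G^*\cong C_4$; two adjacent vertices are of type (K), and the other two are of type (1). - $G_{10}$: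 $G^*\cong C_4\vee K_1$; two adjacent degree-$3$ vertices are of type (K), the degree-$4$ vertex is of type (1K), and the other two are of type (1). -/

import Mathlib

namespace SimpleGraph

section MetricDimension

variable {V : Type*}

/-- The metric representation `r(v | W)` of a vertex `v` with respect to a set `W` of vertices:
the family of the distances from `v` to the members of `W`. -/
noncomputable def metricRepresentation (G : SimpleGraph V) (W : Finset V) (v : V) : W → ℕ :=
  fun w => G.dist v w

/-- `W` resolves `G` if distinct vertices have distinct representations with respect to `W`. -/
def IsResolvingSet (G : SimpleGraph V) (W : Finset V) : Prop :=
  ∀ u v : V, G.metricRepresentation W u = G.metricRepresentation W v → u = v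

/-- The metric dimension `β(G)` of a finite connected graph: the least size of a resolving set. -/
noncomputable def metricDimension (G : SimpleGraph V) : ℕ :=
  sInf {k : ℕ | ∃ W : Finset V, G.IsResolvingSet W ∧ W.card = k}

/-- For a connected graph on a finite vertex set the minimum in `metricDimension` is attained,
so that it is not a junk value. -/
theorem exists_isResolvingSet_card_eq [Fintype V] (G : SimpleGraph V) (hG : G.Connected) :
    ∃ W : Finset V, G.IsResolvingSet W ∧ W.card = G.metricDimension := by
  have h : {k : ℕ | ∃ W : Finset V, G.IsResolvingSet W ∧ W.card = k}.Nonempty := by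
    refine ⟨Finset.univ.card, Finset.univ, ?_, rfl⟩
    intro u v huv
    have h1 := congrFun huv ⟨v, Finset.mem_univ v⟩
    simp only [metricRepresentation, dist_self] at h1
    exact hG.dist_eq_zero_iff.mp h1
  exact Nat.sInf_mem h

end MetricDimension

section Twins

variable {V : Type*}

/-- Distinct vertices `u`, `v` are twins if they have the same neighbours apart from each other. -/
def IsTwin (G : SimpleGraph V) (u v : V) : Prop :=
  u ≠ v ∧ G.neighborSet v \ {u} = G.neighborSet u \ {v}

/-- `u ≡ v` iff `u = v` or `u`, `v` are twins. -/
def TwinEquiv (G : SimpleGraph V) (u v : V) : Prop :=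
  u = v ∨ G.IsTwin u v

theorem twinEquiv_iff (G : SimpleGraph V) (u v : V) :
    G.TwinEquiv u v ↔ ∀ w, w ≠ u → w ≠ v → (G.Adj u w ↔ G.Adj v w) := by
  unfold TwinEquiv IsTwin
  constructor
  · rintro (rfl | ⟨_, h⟩) w hu hv
    · rfl
    · have := Set.ext_iff.mp h w
      simp [hu, hv] at this
      exact this.symm
  · intro h
    by_cases huv : u = v
    · exact Or.inl huv
    · refine Or.inr ⟨huv, ?_⟩
      ext w
      simp only [Set.mem_sdiff, mem_neighborSet, Set.mem_singleton_iff]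
      constructor
      · rintro ⟨h1, h2⟩
        exact ⟨(h w h2 h1.ne').mpr h1, h1.ne'⟩
      · rintro ⟨h1, h2⟩
        exact ⟨(h w h1.ne' h2).mp h1, h1.ne'⟩

theorem twinEquiv_equivalence (G : SimpleGraph V) : Equivalence G.TwinEquiv where
  refl u := Or.inl rfl
  symm {u v} h := by
    rw [twinEquiv_iff] at h ⊢
    exact fun w hv hu => (h w hu hv).symm
  trans {u v w} h1 h2 := by
    rw [twinEquiv_iff] at h1 h2 ⊢
    intro x hu hw
    have ha := h1 w
    have hb := h2 u
    have hc := h1 x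
    have hd := h2 x
    simp only [G.adj_comm] at *
    by_cases hxv : x = v
    · subst hxv
      by_cases huw : u = w
      · subst huw; rfl
      · by_cases hux : u = x
        · subst hux; simp at hu
        · have := ha (Ne.symm huw) (Ne.symm hw)
          have := hb hux huw
          simp only [G.adj_comm] at *
          tauto
    · exact (hc hu hxv).trans (hd hxv hw)

/-- The twin relation `≡` as a setoid. -/
def twinSetoid (G : SimpleGraph V) : Setoid V := ⟨G.TwinEquiv, G.twinEquiv_equivalence⟩

/-- The vertices of the twin graph: the classes `v*` of `≡`. -/
abbrev TwinClass (G : SimpleGraph V) : Type _ := Quotient G.twinSetoid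

/-- The class `v*` of the vertex `v`. -/
def twinClassOf (G : SimpleGraph V) (v : V) : G.TwinClass := Quotient.mk G.twinSetoid v

/-- The set of vertices of `G` that belong to a class. -/
def twinClassSet (G : SimpleGraph V) (a : G.TwinClass) : Set V := {v | G.twinClassOf v = a}

/-- The twin graph `G*`: distinct classes are adjacent iff they have adjacent members
(by `twinGraph_adj` below, the choice of the members does not matter). -/
def twinGraph (G : SimpleGraph V) : SimpleGraph G.TwinClass where
  Adj a b := a ≠ b ∧ ∃ u ∈ G.twinClassSet a, ∃ v ∈ G.twinClassSet b, G.Adj u v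
  symm := ⟨by
    rintro a b ⟨h, u, hu, v, hv, huv⟩
    exact ⟨h.symm, v, hv, u, hu, huv.symm⟩⟩
  loopless := ⟨fun a h => h.1 rfl⟩

theorem twinClassOf_eq_iff (G : SimpleGraph V) (u v : V) :
    G.twinClassOf u = G.twinClassOf v ↔ G.TwinEquiv u v := Quotient.eq

theorem twinGraph_adj (G : SimpleGraph V) (u v : V) :
    G.twinGraph.Adj (G.twinClassOf u) (G.twinClassOf v) ↔ ¬ G.TwinEquiv u v ∧ G.Adj u v := by
  constructor
  · rintro ⟨h, x, hx, y, hy, hxy⟩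
    have hne : ¬ G.TwinEquiv u v := fun h' => h ((G.twinClassOf_eq_iff u v).mpr h')
    refine ⟨hne, ?_⟩
    have hxu : G.TwinEquiv x u := (G.twinClassOf_eq_iff x u).mp hx
    have hyv : G.TwinEquiv y v := (G.twinClassOf_eq_iff y v).mp hy
    have e := G.twinEquiv_equivalence
    have hyu : y ≠ u := by
      rintro rfl
      exact hne hyv
    have hvu : u ≠ v := by
      rintro rfl
      exact hne (e.refl u)
    have h1 : G.Adj u y := ((G.twinEquiv_iff x u).mp hxu y hxy.ne' hyu).mp hxy
    exact (((G.twinEquiv_iff y v).mp hyv u (Ne.symm hyu) hvu).mp h1.symm).symm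
  · rintro ⟨hne, huv⟩
    exact ⟨fun h => hne ((G.twinClassOf_eq_iff u v).mp h), u, rfl, v, rfl, huv⟩

/-- Type (1): the class has exactly one vertex. -/
def IsType1 (G : SimpleGraph V) (a : G.TwinClass) : Prop := (G.twinClassSet a).ncard = 1

/-- Type (K): the class has at least two vertices and induces a complete graph. -/
def IsTypeK (G : SimpleGraph V) (a : G.TwinClass) : Prop :=
  2 ≤ (G.twinClassSet a).ncard ∧ G.induce (G.twinClassSet a) = ⊤

/-- Type (N): the class has at least two vertices and induces an edgeless graph. -/
def IsTypeN (G : SimpleGraph V) (a : G.TwinClass) : Prop :=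
  2 ≤ (G.twinClassSet a).ncard ∧ G.induce (G.twinClassSet a) = ⊥

/-- Type (1K): type (1) or (K). -/
def IsType1K (G : SimpleGraph V) (a : G.TwinClass) : Prop := G.IsType1 a ∨ G.IsTypeK a

/-- Type (1N): type (1) or (N). -/
def IsType1N (G : SimpleGraph V) (a : G.TwinClass) : Prop := G.IsType1 a ∨ G.IsTypeN a

/-- Type (KN): type (K) or (N). -/
def IsTypeKN (G : SimpleGraph V) (a : G.TwinClass) : Prop := G.IsTypeK a ∨ G.IsTypeN a

end Twins

section SmallGraphs

/-- The paw: the triangle `0, 1, 2` with a leaf `3` attached to `0`. -/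
def paw : SimpleGraph (Fin 4) := fromEdgeSet {s(0, 1), s(0, 2), s(1, 2), s(0, 3)}

/-- The kite, `K₄` minus the edge `23`: the degree-3 vertices are `0`, `1`, the degree-2 vertices
are `2`, `3`. -/
def kite : SimpleGraph (Fin 4) := fromEdgeSet {s(0, 1), s(0, 2), s(0, 3), s(1, 2), s(1, 3)}

/-- The kite with a leaf `4` attached to the degree-3 vertex `0` of the kite (so that `0` has
degree 4, `1` has degree 3, and `2`, `3` have degree 2). -/
def kitePendant : SimpleGraph (Fin 5) :=
  fromEdgeSet {s(0, 1), s(0, 2), s(0, 3), s(1, 2), s(1, 3), s(0, 4)}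

/-- The cycle `0, 1, 2, 3, 4` with the chord `02`; the degree-2 vertices are `1`, `3`, `4`, of which
`3` and `4` are adjacent. -/
def cycleFiveOneChord : SimpleGraph (Fin 5) :=
  fromEdgeSet {s(0, 1), s(1, 2), s(2, 3), s(3, 4), s(4, 0), s(0, 2)}

/-- The cycle `0, 1, 2, 3, 4` with the two chords `02` and `03`; the degree-4 vertex is `0`. -/
def cycleFiveTwoChords : SimpleGraph (Fin 5) :=
  fromEdgeSet {s(0, 1), s(1, 2), s(2, 3), s(3, 4), s(4, 0), s(0, 2), s(0, 3)}

/-- `C₄ ∨ K₁`: the cycle `0, 1, 2, 3` with an additional vertex `4` adjacent to all of it. -/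
def cycleFourJoinVertex : SimpleGraph (Fin 5) :=
  fromEdgeSet {s(0, 1), s(1, 2), s(2, 3), s(3, 0), s(4, 0), s(4, 1), s(4, 2), s(4, 3)}

end SmallGraphs

section Structures

variable {V : Type*} (G : SimpleGraph V)

/-- `G*` is `K₃` and has at most one vertex of type (1K). -/
def StructureG1 : Prop :=
  Nonempty (completeGraph (Fin 3) ≃g G.twinGraph) ∧
    ∀ a b : G.TwinClass, G.IsType1K a → G.IsType1K b → a = b

/-- `G*` is the path `0, 1, 2`, and (a) the middle vertex is of type (N) and one of the leaves is of
type (K), or (b) one of the leaves is of type (K) and the other is of type (KN). -/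
def StructureG2 : Prop :=
  ∃ e : pathGraph 3 ≃g G.twinGraph,
    (G.IsTypeN (e 1) ∧ (G.IsTypeK (e 0) ∨ G.IsTypeK (e 2))) ∨
    ((G.IsTypeK (e 0) ∧ G.IsTypeKN (e 2)) ∨ (G.IsTypeK (e 2) ∧ G.IsTypeKN (e 0)))

/-- `G*` is the paw; one degree-2 vertex is of type (N), the other one of type (1K), the leaf of
type (1N); if a degree-2 vertex is of type (K), then neither the leaf nor the degree-3 vertex is
of type (N). -/
def StructureG3 : Prop :=
  ∃ e : paw ≃g G.twinGraph,
    ((G.IsTypeN (e 1) ∧ G.IsType1K (e 2)) ∨ (G.IsTypeN (e 2) ∧ G.IsType1K (e 1))) ∧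
    G.IsType1N (e 3) ∧
    ((G.IsTypeK (e 1) ∨ G.IsTypeK (e 2)) → ¬ G.IsTypeN (e 3) ∧ ¬ G.IsTypeN (e 0))

/-- `G*` is `C₅` and each vertex is of type (1). -/
def StructureG4 : Prop :=
  Nonempty (cycleGraph 5 ≃g G.twinGraph) ∧ ∀ a : G.TwinClass, G.IsType1 a

/-- `G*` is `C₅` with a chord, the adjacent degree-2 vertices are of type (1) and the other vertices
of type (1K). -/
def StructureG5 : Prop :=
  ∃ e : cycleFiveOneChord ≃g G.twinGraph,
    G.IsType1 (e 3) ∧ G.IsType1 (e 4) ∧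
    G.IsType1K (e 0) ∧ G.IsType1K (e 1) ∧ G.IsType1K (e 2)

/-- `G*` is `C₅` with two adjacent chords; the vertices other than the degree-4 vertex are of type
(1K), no two distinct non-adjacent vertices are both of type (K), and of two adjacent vertices it is
never the case that one is of type (K) and the other of type (N). -/
def StructureG6 : Prop :=
  ∃ e : cycleFiveTwoChords ≃g G.twinGraph,
    (∀ i : Fin 5, i ≠ 0 → G.IsType1K (e i)) ∧
    (∀ a b : G.TwinClass, a ≠ b → ¬ G.twinGraph.Adj a b → ¬ (G.IsTypeK a ∧ G.IsTypeK b)) ∧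
    (∀ a b : G.TwinClass, G.twinGraph.Adj a b → ¬ (G.IsTypeK a ∧ G.IsTypeN b))

/-- `G*` is a kite with a pendant edge at a degree-3 vertex; the leaf is of type (1), the degree-4
and degree-3 vertices of type (1K), one degree-2 vertex of type (K) and the other of type (1). -/
def StructureG7 : Prop :=
  ∃ e : kitePendant ≃g G.twinGraph,
    G.IsType1 (e 4) ∧ G.IsType1K (e 0) ∧ G.IsType1K (e 1) ∧
    ((G.IsTypeK (e 2) ∧ G.IsType1 (e 3)) ∨ (G.IsTypeK (e 3) ∧ G.IsType1 (e 2)))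

/-- `G*` is the kite; one degree-2 vertex is of type (K) and the other of type (1), one degree-3
vertex is of type (N) and the other of type (1K). -/
def StructureG8 : Prop :=
  ∃ e : kite ≃g G.twinGraph,
    ((G.IsTypeK (e 2) ∧ G.IsType1 (e 3)) ∨ (G.IsTypeK (e 3) ∧ G.IsType1 (e 2))) ∧
    ((G.IsTypeN (e 0) ∧ G.IsType1K (e 1)) ∨ (G.IsTypeN (e 1) ∧ G.IsType1K (e 0)))

/-- `G*` is `C₄`; two adjacent vertices are of type (K) and the others of type (1). -/
def StructureG9 : Prop :=
  ∃ e : cycleGraph 4 ≃g G.twinGraph,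
    G.IsTypeK (e 0) ∧ G.IsTypeK (e 1) ∧ G.IsType1 (e 2) ∧ G.IsType1 (e 3)

/-- `G*` is `C₄ ∨ K₁`; two adjacent degree-3 vertices are of type (K), the degree-4 vertex is of type
(1K), and the others are of type (1). -/
def StructureG10 : Prop :=
  ∃ e : cycleFourJoinVertex ≃g G.twinGraph,
    G.IsTypeK (e 0) ∧ G.IsTypeK (e 1) ∧ G.IsType1 (e 2) ∧ G.IsType1 (e 3) ∧ G.IsType1K (e 4)

end Structures

end SimpleGraph

/-!
Let `G` be connected of diameter two. A set `W` of vertices is resolving if and only if any two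
vertices outside of `W` are told apart by adjacency to a member of `W` (`isResolvingSet_iff`), so
`β(G) = n - 3` says that the largest set of vertices with a resolving complement has size three.
Such a set contains no twins, and whether a choice of one vertex from each class of a set `S` of
twin classes has a resolving complement depends only on the twin graph and the types of its
vertices. These data form a `TwinPattern`, the property of `S` is `TwinPattern.Separated`, and
`β(G) = n - 3` becomes the statement that the pattern of `G` has a separated set of three classes,
but none of four (`exists_isResolvingSet_iff_exists_separated`).

The absence of separated sets of four classes passes to the pattern induced on a subset of the
classes, so that all such patterns can be found by adding one class at a time. Members of distinct
classes of `G` are not twins, and non-adjacent classes of `G` have a common neighbour. A pair of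
classes that violates one of these conditions in an induced pattern therefore tells something
about a class that is still missing, which is taken as the next one: a class that separates the
pair, or a common neighbour of it. Under this rule no pattern with seven classes is ever reached
(`exists_codeOn_mem_next` is the step, `exists_codeOn_mem_of_search` the conclusion), and the
patterns on the way that satisfy both conditions and have a separated set of three classes are
those of the ten structures.

The search is carried out by a function on codes of patterns as natural numbers, which the kernel
evaluates (`search_check`); the same representation serves to verify that the ten structures have
a separated set of three classes and none of four (`shapes_check`).
-/

/-! ### Resolving sets in graphs of diameter two -/

namespace SimpleGraph

section DiameterTwo

variable {V : Type*} {G : SimpleGraph V}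

theorem dist_eq_two_of_not_adj (hconn : G.Connected) (hdiam : G.diam = 2) {u v : V}
    (huv : u ≠ v) (h : ¬ G.Adj u v) : G.dist u v = 2 := by
  have h1 : G.dist u v ≤ G.diam := dist_le_diam (ediam_ne_top_of_diam_ne_zero (by omega))
  have h2 := hconn.one_lt_dist_of_ne_of_not_adj huv h
  omega

theorem exists_common_neighbor (hconn : G.Connected) (hdiam : G.diam = 2) {u v : V}
    (huv : u ≠ v) (h : ¬ G.Adj u v) : ∃ w, G.Adj u w ∧ G.Adj w v := by
  obtain ⟨p, hp⟩ := hconn.exists_walk_length_eq_dist u v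
  rw [dist_eq_two_of_not_adj hconn hdiam huv h] at hp
  match p, hp with
  | .cons (v := w) huw (.cons hwv .nil), _ => exact ⟨w, huw, hwv⟩

/-- In a connected graph of diameter two the distances `0`, `1`, `2` stand for equality, adjacency
and non-adjacency, so that outside `W` only adjacency to the members of `W` matters. -/
theorem isResolvingSet_iff (hconn : G.Connected) (hdiam : G.diam = 2) (W : Finset V) :
    G.IsResolvingSet W ↔
      ∀ u v, u ∉ W → v ∉ W → u ≠ v → ∃ w ∈ W, ¬ (G.Adj u w ↔ G.Adj v w) := by
  have key : ∀ u w, u ≠ w → G.dist u w = 1 ∧ G.Adj u w ∨ G.dist u w = 2 ∧ ¬ G.Adj u w := by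
    intro u w huw
    by_cases h : G.Adj u w
    · exact Or.inl ⟨dist_eq_one_iff_adj.mpr h, h⟩
    · exact Or.inr ⟨dist_eq_two_of_not_adj hconn hdiam huw h, h⟩
  constructor
  · intro h u v hu hv huv
    by_contra! hc
    refine huv (h u v (funext fun w => ?_))
    have h1 := key u w (fun e => hu (e ▸ w.2))
    have h2 := key v w (fun e => hv (e ▸ w.2))
    have h3 := hc w w.2
    simp only [metricRepresentation]
    grind
  · intro h u v huv
    have hd : ∀ w ∈ W, G.dist u w = G.dist v w := fun w hw => congrFun huv ⟨w, hw⟩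
    by_cases hu : u ∈ W
    · have := hd u hu
      rw [dist_self, eq_comm, hconn.dist_eq_zero_iff] at this
      exact this.symm
    by_cases hv : v ∈ W
    · have := hd v hv
      rw [dist_self, hconn.dist_eq_zero_iff] at this
      exact this
    by_contra hne
    obtain ⟨w, hw, hn⟩ := h u v hu hv hne
    have h1 := key u w (fun e => hu (e ▸ hw))
    have h2 := key v w (fun e => hv (e ▸ hw))
    have h3 := hd w hw
    grind

theorem IsResolvingSet.mono {W W' : Finset V} (h : G.IsResolvingSet W) (hW : W ⊆ W') :
    G.IsResolvingSet W' := fun u v huv =>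
  h u v (funext fun w => congrFun huv ⟨w, hW w.2⟩)

/-- Supersets of resolving sets are resolving, so that two sizes suffice to fix the minimum. -/
theorem metricDimension_add_three_eq_iff [Fintype V] (hconn : G.Connected) :
    G.metricDimension + 3 = Fintype.card V ↔
      (∃ W : Finset V, G.IsResolvingSet W ∧ W.card + 3 = Fintype.card V) ∧
      ¬ ∃ W : Finset V, G.IsResolvingSet W ∧ W.card + 4 = Fintype.card V := by
  obtain ⟨W₀, hW₀, hc₀⟩ := G.exists_isResolvingSet_card_eq hconn
  have hmin : ∀ W : Finset V, G.IsResolvingSet W → G.metricDimension ≤ W.card :=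
    fun W hW => Nat.sInf_le ⟨W, hW, rfl⟩
  constructor
  · intro h
    refine ⟨⟨W₀, hW₀, by omega⟩, ?_⟩
    rintro ⟨W, hW, hc⟩
    have := hmin W hW
    omega
  · rintro ⟨⟨W, hW, hc⟩, hn⟩
    have h1 := hmin W hW
    by_contra hne
    obtain ⟨W', hsub, hc'⟩ := Finset.exists_superset_card_eq (s := W₀)
      (n := Fintype.card V - 4) (by omega) (by omega)
    exact hn ⟨W', hW₀.mono hsub, by omega⟩

end DiameterTwo

end SimpleGraph

/-! ### Twin patterns -/

/-- A twin graph together with the types of its vertices: `thick a` says that the class `a` has at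
least two members, and the diagonal entry `adj a a` that it is of type (K). With this convention
`adj a b` tells whether any two distinct vertices of the classes `a` and `b` are adjacent, also for
`a = b`. -/
structure TwinPattern (T : Type*) where
  adj : T → T → Bool
  thick : T → Bool
  adj_comm : ∀ a b, adj a b = adj b a
  thick_of_adj_self : ∀ a, adj a a = true → thick a = true

namespace TwinPattern

variable {T : Type*} (P : TwinPattern T)

/-- The pattern counterpart of the statement that one vertex can be chosen from each class in `S`
such that the complement of the chosen set resolves the graph: two classes in `S` are told apart by
an unchosen vertex, which exists outside of `S` and in the thick classes. -/
def Separated (S : Set T) : Prop :=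
  ∀ a ∈ S, ∀ b ∈ S, a ≠ b → ∃ l, (P.thick l = true ∨ l ∉ S) ∧ P.adj a l ≠ P.adj b l

/-- Members of distinct classes are not twins. -/
def Reduced : Prop := ∀ a b, a ≠ b → P.Separated {a, b}

/-- Distinct non-adjacent classes have a common neighbour. -/
def DiamTwo : Prop :=
  ∀ a b, a ≠ b → P.adj a b = false → ∃ l, P.adj a l = true ∧ P.adj b l = true

end TwinPattern

/-! ### The pattern of a graph -/

namespace SimpleGraph

section PatternOfGraph

variable {V : Type*} (G : SimpleGraph V)

theorem TwinEquiv.adj_iff {G : SimpleGraph V} {u v w : V} (h : G.TwinEquiv u v) (hu : w ≠ u)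
    (hv : w ≠ v) : G.Adj u w ↔ G.Adj v w := (G.twinEquiv_iff u v).mp h w hu hv

/-- A twin class is homogeneous: a single edge forces it to be a clique. -/
theorem adj_of_adj_of_twinEquiv {u w x y : V} (huw : G.TwinEquiv u w) (hux : G.TwinEquiv u x)
    (huy : G.TwinEquiv u y) (h : G.Adj u w) (hxy : x ≠ y) : G.Adj x y := by
  have e := G.twinEquiv_equivalence
  have step : ∀ {a b c : V}, G.TwinEquiv a c → G.Adj a b → b ≠ c → G.Adj c b :=
    fun hac hab hbc => (hac.adj_iff hab.ne' hbc).mp hab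
  by_cases hwx : w = x
  · subst hwx
    by_cases huy' : u = y
    · exact huy' ▸ h.symm
    · exact (step huy h hxy).symm
  · have h1 : G.Adj x w := step hux h hwx
    exact (step (e.trans (e.symm huw) huy) h1.symm hxy).symm

open Classical in
/-- The twin graph of `G` with the types of its vertices, as a pattern. -/
noncomputable def twinPattern : TwinPattern G.TwinClass where
  adj a b := if a = b then decide (G.IsTypeK a) else decide (G.twinGraph.Adj a b)
  thick a := decide (2 ≤ (G.twinClassSet a).ncard)
  adj_comm a b := by
    by_cases h : a = b
    · simp [h]
    · simp [h, Ne.symm h, G.twinGraph.adj_comm]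
  thick_of_adj_self a h := by
    simp only [if_true, decide_eq_true_eq] at h
    simpa using h.1

theorem twinPattern_adj_self (a : G.TwinClass) :
    G.twinPattern.adj a a = true ↔ G.IsTypeK a := by
  simp [twinPattern]

theorem twinPattern_adj_of_ne {a b : G.TwinClass} (h : a ≠ b) :
    G.twinPattern.adj a b = true ↔ G.twinGraph.Adj a b := by
  simp [twinPattern, h]

theorem twinPattern_thick (a : G.TwinClass) :
    G.twinPattern.thick a = true ↔ 2 ≤ (G.twinClassSet a).ncard := by
  simp [twinPattern]

variable [Finite V]

theorem two_le_ncard_twinClassSet_iff {a : G.TwinClass} {u : V} (hu : G.twinClassOf u = a) :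
    2 ≤ (G.twinClassSet a).ncard ↔ ∃ w, w ≠ u ∧ G.twinClassOf w = a := by
  rw [show (2 ≤ (G.twinClassSet a).ncard) = (1 < (G.twinClassSet a).ncard) from rfl,
    Set.one_lt_ncard_iff_nontrivial]
  constructor
  · rintro h
    obtain ⟨w, hw, hne⟩ := h.exists_ne u
    exact ⟨w, hne, hw⟩
  · rintro ⟨w, hne, hw⟩
    exact ⟨w, hw, u, hu, hne⟩

/-- Type (K) can be read off from any pair of distinct members of a class. -/
theorem adj_iff_isTypeK {u w : V} (huw : u ≠ w) (h : G.twinClassOf u = G.twinClassOf w) :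
    G.Adj u w ↔ G.IsTypeK (G.twinClassOf u) := by
  constructor
  · intro hadj
    refine ⟨(G.two_le_ncard_twinClassSet_iff rfl).mpr ⟨w, huw.symm, h.symm⟩, ?_⟩
    ext ⟨x, hx⟩ ⟨y, hy⟩
    have hx' := (G.twinClassOf_eq_iff u x).mp (Eq.symm hx)
    have hy' := (G.twinClassOf_eq_iff u y).mp (Eq.symm hy)
    have huw' := (G.twinClassOf_eq_iff u w).mp h
    simp only [comap_adj, Function.Embedding.subtype_apply, top_adj, ne_eq, Subtype.mk.injEq]
    exact ⟨fun hxy => hxy.ne, G.adj_of_adj_of_twinEquiv huw' hx' hy' hadj⟩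
  · rintro ⟨_, hK⟩
    have : (G.induce (G.twinClassSet (G.twinClassOf u))).Adj ⟨u, rfl⟩ ⟨w, h.symm⟩ := by
      rw [hK]
      simpa [Subtype.ext_iff] using huw
    exact this

theorem isTypeN_iff (a : G.TwinClass) :
    G.IsTypeN a ↔ 2 ≤ (G.twinClassSet a).ncard ∧ ¬ G.IsTypeK a := by
  constructor
  · rintro ⟨h2, h⟩
    refine ⟨h2, fun hK => ?_⟩
    obtain ⟨u, hu, v, hv, huv⟩ := Set.one_lt_ncard_iff_nontrivial.mp h2
    have h3 : (G.induce (G.twinClassSet a)).Adj ⟨u, hu⟩ ⟨v, hv⟩ := by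
      rw [hK.2]
      simpa using huv
    rw [h] at h3
    exact h3
  · rintro ⟨h2, hK⟩
    refine ⟨h2, ?_⟩
    ext ⟨x, hx⟩ ⟨y, hy⟩
    simp only [comap_adj, Function.Embedding.subtype_apply, bot_adj, iff_false]
    intro hxy
    obtain rfl : G.twinClassOf x = a := hx
    exact hK ((G.adj_iff_isTypeK hxy.ne (Eq.symm hy)).mp hxy)

theorem isType1_iff (a : G.TwinClass) :
    G.IsType1 a ↔ ¬ 2 ≤ (G.twinClassSet a).ncard := by
  have : (G.twinClassSet a).ncard ≠ 0 := by
    obtain ⟨u, rfl⟩ := Quotient.exists_rep a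
    exact Set.ncard_ne_zero_of_mem (a := u) rfl
  unfold IsType1
  omega

theorem twinPattern_thick_of_ne {u w : V} (hne : w ≠ u) (h : G.twinClassOf w = G.twinClassOf u) :
    G.twinPattern.thick (G.twinClassOf u) = true :=
  (G.twinPattern_thick _).mpr ((G.two_le_ncard_twinClassSet_iff rfl).mpr ⟨w, hne, h⟩)

theorem twinPattern_adj {u w : V} (h : u ≠ w) :
    G.twinPattern.adj (G.twinClassOf u) (G.twinClassOf w) = true ↔ G.Adj u w := by
  by_cases huw : G.twinClassOf u = G.twinClassOf w
  · rw [G.adj_iff_isTypeK h huw, ← huw, twinPattern_adj_self]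
  · rw [twinPattern_adj_of_ne G huw, twinGraph_adj, ← twinClassOf_eq_iff]
    exact and_iff_right huw

theorem twinPattern_adj_ne_iff {u v w : V} (hu : u ≠ w) (hv : v ≠ w) :
    G.twinPattern.adj (G.twinClassOf u) (G.twinClassOf w) ≠
      G.twinPattern.adj (G.twinClassOf v) (G.twinClassOf w) ↔ ¬ (G.Adj u w ↔ G.Adj v w) := by
  rw [← G.twinPattern_adj hu, ← G.twinPattern_adj hv, ← Bool.eq_iff_iff]

theorem twinPattern_reduced : G.twinPattern.Reduced := by
  have key : ∀ a b : G.TwinClass, a ≠ b → ∃ l,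
      (G.twinPattern.thick l = true ∨ l ∉ ({a, b} : Set _)) ∧
        G.twinPattern.adj a l ≠ G.twinPattern.adj b l := by
    intro a b hab
    obtain ⟨u, rfl⟩ := Quotient.exists_rep a
    obtain ⟨v, rfl⟩ := Quotient.exists_rep b
    change G.twinClassOf u ≠ G.twinClassOf v at hab
    rw [ne_eq, twinClassOf_eq_iff, twinEquiv_iff] at hab
    push Not at hab
    obtain ⟨w, hwu, hwv, hw⟩ := hab
    refine ⟨G.twinClassOf w, ?_,
      (G.twinPattern_adj_ne_iff hwu.symm hwv.symm).mpr (by tauto)⟩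
    by_cases h1 : G.twinClassOf w = G.twinClassOf u
    · exact Or.inl (h1 ▸ G.twinPattern_thick_of_ne hwu h1)
    by_cases h2 : G.twinClassOf w = G.twinClassOf v
    · exact Or.inl (h2 ▸ G.twinPattern_thick_of_ne hwv h2)
    · refine Or.inr ?_
      rintro (h | h)
      · exact h1 h
      · exact h2 h
  rintro a b hab x (rfl | rfl) y (rfl | rfl) hxy
  · exact absurd rfl hxy
  · exact key _ _ hab
  · rw [Set.pair_comm]
    exact key _ _ hxy
  · exact absurd rfl hxy

theorem twinPattern_diamTwo (hconn : G.Connected) (hdiam : G.diam = 2) :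
    G.twinPattern.DiamTwo := by
  intro a b hab hadj
  obtain ⟨u, rfl⟩ := Quotient.exists_rep a
  obtain ⟨v, rfl⟩ := Quotient.exists_rep b
  have huv : u ≠ v := fun h => hab (h ▸ rfl)
  have hn : ¬ G.Adj u v := fun h => by
    have := (G.twinPattern_adj huv).mpr h
    rw [twinClassOf, twinClassOf, hadj] at this
    cases this
  obtain ⟨w, huw, hwv⟩ := exists_common_neighbor hconn hdiam huv hn
  exact ⟨G.twinClassOf w, (G.twinPattern_adj huw.ne).mpr huw,
    (G.twinPattern_adj hwv.ne').mpr hwv.symm⟩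

end PatternOfGraph

/-- The complement of a resolving set meets every twin class at most once, and whether it does its
job depends on the classes it meets only. -/
theorem exists_isResolvingSet_iff_exists_separated {V : Type*} [Fintype V] (G : SimpleGraph V)
    (hconn : G.Connected) (hdiam : G.diam = 2) (r : ℕ) :
    (∃ W : Finset V, G.IsResolvingSet W ∧ W.card + r = Fintype.card V) ↔
      ∃ S : Finset G.TwinClass, S.card = r ∧ G.twinPattern.Separated S := by
  classical
  constructor
  · rintro ⟨W, hW, hr⟩
    rw [isResolvingSet_iff hconn hdiam] at hW
    have hinj : Set.InjOn G.twinClassOf ((Wᶜ : Finset V) : Set V) := by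
      intro u hu v hv huv
      by_contra hne
      simp only [Finset.coe_compl, Set.mem_compl_iff, Finset.mem_coe] at hu hv
      obtain ⟨w, hw, h⟩ := hW u v hu hv hne
      exact h (((G.twinClassOf_eq_iff u v).mp huv).adj_iff (fun e => hu (e ▸ hw))
        (fun e => hv (e ▸ hw)))
    refine ⟨(Wᶜ).image G.twinClassOf, ?_, ?_⟩
    · rw [Finset.card_image_of_injOn hinj, Finset.card_compl]
      omega
    · intro a ha b hb hab
      simp only [Finset.coe_image, Finset.coe_compl, Set.mem_image, Set.mem_compl_iff,
        Finset.mem_coe] at ha hb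
      obtain ⟨u, hu, rfl⟩ := ha
      obtain ⟨v, hv, rfl⟩ := hb
      obtain ⟨w, hw, h⟩ := hW u v hu hv (fun e => hab (e ▸ rfl))
      have hne : ∀ x, x ∉ W → x ≠ w := fun x hx e => hx (e ▸ hw)
      refine ⟨G.twinClassOf w, ?_, (G.twinPattern_adj_ne_iff (hne u hu) (hne v hv)).mpr h⟩
      by_cases hmem : G.twinClassOf w ∈ (((Wᶜ).image G.twinClassOf : Finset _) : Set G.TwinClass)
      · simp only [Finset.coe_image, Finset.coe_compl, Set.mem_image, Set.mem_compl_iff,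
          Finset.mem_coe] at hmem
        obtain ⟨x, hx, hxw⟩ := hmem
        exact Or.inl (hxw ▸ G.twinPattern_thick_of_ne (hne x hx).symm hxw.symm)
      · exact Or.inr hmem
  · rintro ⟨S, hr, hS⟩
    have hout : ∀ a : G.TwinClass, G.twinClassOf a.out = a := fun a => Quotient.out_eq a
    have hinj : Function.Injective (Quotient.out : G.TwinClass → V) := Quotient.out_injective
    refine ⟨(S.image Quotient.out)ᶜ, ?_, ?_⟩
    · rw [isResolvingSet_iff hconn hdiam]
      intro u v hu hv huv
      simp only [Finset.mem_compl, not_not, Finset.mem_image] at hu hv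
      obtain ⟨a, ha, rfl⟩ := hu
      obtain ⟨b, hb, rfl⟩ := hv
      obtain ⟨l, hl, hne⟩ := hS a ha b hb (fun e => huv (e ▸ rfl))
      obtain ⟨w, hw, hwl⟩ : ∃ w, w ∉ S.image Quotient.out ∧ G.twinClassOf w = l := by
        by_cases hlS : l ∈ S
        · have hthick := (G.twinPattern_thick l).mp (hl.resolve_right (fun h => h hlS))
          obtain ⟨w, hwl, hw⟩ := (G.two_le_ncard_twinClassSet_iff (hout l)).mp hthick
          refine ⟨w, fun hmem => hwl ?_, hw⟩
          obtain ⟨c, _, rfl⟩ := Finset.mem_image.mp hmem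
          rw [← hw, hout]
        · refine ⟨l.out, fun hmem => hlS ?_, hout l⟩
          obtain ⟨c, hc, hcl⟩ := Finset.mem_image.mp hmem
          exact hinj hcl ▸ hc
      refine ⟨w, Finset.mem_compl.mpr hw, ?_⟩
      have h1 : ∀ c ∈ S, c.out ≠ w := fun c hc e => hw (Finset.mem_image.mpr ⟨c, hc, e⟩)
      rw [← G.twinPattern_adj_ne_iff (h1 a ha) (h1 b hb), hout, hout, hwl]
      exact hne
    · rw [Finset.card_compl, Finset.card_image_of_injective _ hinj, hr]
      have : S.card ≤ Fintype.card V := by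
        rw [← Finset.card_image_of_injective S hinj]
        exact Finset.card_le_univ _
      omega

end SimpleGraph

/-! ### Patterns on few classes encoded as natural numbers -/

namespace TwinSearch

/-- Passes `n` to `k` in the form of a numeral: evaluation in the kernel is lazy, and this keeps it
from handing on, and repeating, an unfinished computation. -/
def force {β : Type} (n : ℕ) (k : ℕ → β) : β := Nat.casesOn n (k 0) fun n => k (Nat.succ n)

@[simp] theorem force_eq {β : Type} (n : ℕ) (k : ℕ → β) : force n k = k n := by
  cases n <;> rfl

/-- `List.foldr`, in a form that the kernel evaluates with few reduction steps. -/
def fold {α β : Type} (f : α → β → β) (b : β) (l : List α) : β :=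
  List.rec b (fun a _ ih => f a ih) l

@[simp] theorem fold_nil {α β : Type} (f : α → β → β) (b : β) : fold f b [] = b := rfl

@[simp] theorem fold_cons {α β : Type} (f : α → β → β) (b : β) (a : α) (l : List α) :
    fold f b (a :: l) = f a (fold f b l) := rfl

/-- The number with the digits `f a`, for `a` in `l`, to the base `q`, the lowest digit first. -/
def pack (q : ℕ) {α : Type} (f : α → ℕ) (l : List α) : ℕ :=
  fold (fun a x => Nat.add (f a) (Nat.mul q x)) 0 l

@[simp] theorem pack_nil (q : ℕ) {α : Type} (f : α → ℕ) : pack q f [] = 0 := rfl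

@[simp] theorem pack_cons (q : ℕ) {α : Type} (f : α → ℕ) (a : α) (l : List α) :
    pack q f (a :: l) = f a + q * pack q f l := rfl

theorem pack_append_singleton (q : ℕ) {α : Type} (f : α → ℕ) (l : List α) (y : α) :
    pack q f (l ++ [y]) = pack q f l + q ^ l.length * f y := by
  induction l with
  | nil => simp
  | cons a l ih => simp [ih]; ring

theorem pack_congr (q : ℕ) {α : Type} {f g : α → ℕ} {l : List α} (h : ∀ a ∈ l, f a = g a) :
    pack q f l = pack q g l := by
  induction l with
  | nil => rfl
  | cons a l ih => simp_all

theorem pack_map (q : ℕ) {α β : Type} (f : β → ℕ) (g : α → β) (l : List α) :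
    pack q f (l.map g) = pack q (fun a => f (g a)) l := by
  induction l with
  | nil => rfl
  | cons a l ih => simp [ih]

theorem pack_add_mul (q n : ℕ) {α : Type} (f g : α → ℕ) (l : List α) :
    pack q (fun a => f a + n * g a) l = pack q f l + n * pack q g l := by
  induction l with
  | nil => rfl
  | cons a l ih => simp [ih]; ring

theorem pack_lt {q : ℕ} {α : Type} {f : α → ℕ} {l : List α} (h : ∀ a ∈ l, f a < q) :
    pack q f l < q ^ l.length := by
  induction l with
  | nil => simp
  | cons a l ih =>
    have h1 := h a (by simp)
    have h2 := ih fun b hb => h b (by simp [hb])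
    rw [pack_cons, List.length_cons, pow_succ]
    nlinarith

theorem testBit_pack {e : ℕ} {α : Type} {f : α → ℕ} {l : List α} (h : ∀ a ∈ l, f a < 2 ^ e)
    (i : ℕ) {j : ℕ} (hj : j < e) :
    (pack (2 ^ e) f l).testBit (e * i + j) = (l[i]?).any fun a => (f a).testBit j := by
  induction l generalizing i with
  | nil => simp
  | cons a l ih =>
    rw [pack_cons, add_comm, Nat.testBit_two_pow_mul_add _ (h a (by simp))]
    cases i with
    | zero => simp [hj]
    | succ i =>
      rw [if_neg (by rw [Nat.mul_succ]; omega),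
        show e * (i + 1) + j - e = e * i + j by rw [Nat.mul_succ]; omega,
        ih (fun b hb => h b (by simp [hb]))]
      simp

/-- The number that encodes an adjacency matrix `A` (with diagonal entries) and a set `M` on the
list `l` of at most seven objects: the row of the `i`-th object has its bits from position `8 * i`
on, and the bits of `M` start at position `56`; the numeral is `2 ^ 56`. -/
def code {α : Type} (A : α → α → ℕ) (M : α → ℕ) (l : List α) : ℕ :=
  Nat.add (pack 256 (fun a => pack 2 (A a) l) l) (Nat.mul 72057594037927936 (pack 2 M l))

/-- The code of a Boolean matrix on `0, …, m - 1`. -/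
def matrixCode (A : ℕ → ℕ → Bool) (M : ℕ → Bool) (m : ℕ) : ℕ :=
  code (fun i j => (A i j).toNat) (fun i => (M i).toNat) (List.range m)

section Bits

variable {A : ℕ → ℕ → Bool} {M : ℕ → Bool} {m : ℕ}

theorem testBit_pack_two (f : ℕ → Bool) (m j : ℕ) :
    (pack 2 (fun i => (f i).toNat) (List.range m)).testBit j = (decide (j < m) && f j) := by
  have h := testBit_pack (e := 1) (f := fun i => (f i).toNat) (l := List.range m)
    (fun a _ => Bool.toNat_lt _) j (j := 0) one_pos
  rw [one_mul, add_zero, pow_one] at h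
  rw [h]
  by_cases hj : j < m
  · cases hf : f j <;> simp [hj, hf]
  · simp [hj]

theorem pack_two_lt (f : ℕ → Bool) (m : ℕ) :
    pack 2 (fun i => (f i).toNat) (List.range m) < 2 ^ m := by
  have := pack_lt (q := 2) (f := fun i => (f i).toNat) (l := List.range m)
    (fun a _ => Bool.toNat_lt _)
  simpa using this

theorem rows_lt (hm : m ≤ 7) :
    pack 256 (fun i => pack 2 (fun j => (A i j).toNat) (List.range m)) (List.range m) < 2 ^ 56 := by
  have h := pack_lt (q := 256) (l := List.range m)
    (f := fun i => pack 2 (fun j => (A i j).toNat) (List.range m))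
    (fun i _ => (pack_two_lt (A i) m).trans_le ((Nat.pow_le_pow_right two_pos hm).trans (by simp)))
  rw [List.length_range] at h
  exact h.trans_le ((Nat.pow_le_pow_right (by simp) hm).trans (by simp))

theorem testBit_matrixCode_row (hm : m ≤ 7) {i j : ℕ} (hi : i < m) (hj : j < 8) :
    (matrixCode A M m).testBit (8 * i + j) = (decide (j < m) && A i j) := by
  have h := testBit_pack (e := 8) (l := List.range m)
    (f := fun i => pack 2 (fun j => (A i j).toNat) (List.range m))
    (fun i _ => (pack_two_lt (A i) m).trans_le (Nat.pow_le_pow_right two_pos (by omega))) i hj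
  have h2 : matrixCode A M m = 2 ^ 56 * pack 2 (fun i => (M i).toNat) (List.range m) +
      pack 256 (fun i => pack 2 (fun j => (A i j).toNat) (List.range m)) (List.range m) :=
    add_comm _ _
  rw [h2, Nat.testBit_two_pow_mul_add _ (rows_lt hm), if_pos (by omega)]
  rw [show (256 : ℕ) = 2 ^ 8 from rfl, h]
  simp [hi, testBit_pack_two]

theorem testBit_matrixCode_mask (hm : m ≤ 7) (j : ℕ) :
    (matrixCode A M m).testBit (56 + j) = (decide (j < m) && M j) := by
  have h2 : matrixCode A M m = 2 ^ 56 * pack 2 (fun i => (M i).toNat) (List.range m) +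
      pack 256 (fun i => pack 2 (fun j => (A i j).toNat) (List.range m)) (List.range m) :=
    add_comm _ _
  rw [h2, Nat.testBit_two_pow_mul_add _ (rows_lt hm), if_neg (by omega),
    Nat.add_sub_cancel_left, testBit_pack_two]

theorem matrixCode_congr {A' : ℕ → ℕ → Bool} {M' : ℕ → Bool}
    (hA : ∀ i < m, ∀ j < m, A i j = A' i j) (hM : ∀ i < m, M i = M' i) :
    matrixCode A M m = matrixCode A' M' m := by
  have h1 := pack_congr 256 (l := List.range m)
    (f := fun i => pack 2 (fun j => (A i j).toNat) (List.range m))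
    (g := fun i => pack 2 (fun j => (A' i j).toNat) (List.range m))
    (fun i hi => pack_congr 2 fun j hj => by
      rw [hA i (List.mem_range.mp hi) j (List.mem_range.mp hj)])
  have h2 := pack_congr 2 (l := List.range m) (f := fun i => (M i).toNat)
    (g := fun i => (M' i).toNat) (fun i hi => by rw [hM i (List.mem_range.mp hi)])
  simp only [matrixCode, code, h1, h2]

theorem matrixCode_inj (hm : m ≤ 7) {A' : ℕ → ℕ → Bool} {M' : ℕ → Bool}
    (h : matrixCode A M m = matrixCode A' M' m) :
    (∀ i < m, ∀ j < m, A i j = A' i j) ∧ ∀ i < m, M i = M' i := by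
  constructor
  · intro i hi j hj
    have h1 := testBit_matrixCode_row (A := A) (M := M) hm hi (j := j) (by omega)
    rw [h, testBit_matrixCode_row hm hi (by omega)] at h1
    simpa [hj] using h1.symm
  · intro j hj
    have h1 := testBit_matrixCode_mask (A := A) (M := M) hm j
    rw [h, testBit_matrixCode_mask hm j] at h1
    simpa [hj] using h1.symm

/-- The effect on the code of one more object; compare `extend`. -/
theorem matrixCode_succ (hA : ∀ i < m, A i m = A m i) :
    matrixCode A M (m + 1) = matrixCode A M m +
      (pack 2 (fun j => (A m j).toNat) (List.range m) * 2 ^ (8 * m) +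
        pack 256 (fun j => (A m j).toNat) (List.range m) * 2 ^ m) +
      ((A m m).toNat * 2 ^ (9 * m) + (M m).toNat * 2 ^ (56 + m)) := by
  have h1 :
      pack 256 (fun i => pack 2 (fun j => (A i j).toNat) (List.range (m + 1))) (List.range m) =
      pack 256 (fun i => pack 2 (fun j => (A i j).toNat) (List.range m)) (List.range m) +
        2 ^ m * pack 256 (fun j => (A m j).toNat) (List.range m) := by
    rw [← pack_add_mul]
    refine pack_congr _ fun i hi => ?_
    rw [List.range_succ, pack_append_singleton, List.length_range, hA i (List.mem_range.mp hi)]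
  have h2 : (256 : ℕ) ^ m = 2 ^ (8 * m) := by rw [pow_mul]; norm_num
  simp only [matrixCode, code, Nat.add_eq, Nat.mul_eq]
  rw [show (List.range (m + 1)) = List.range m ++ [m] from List.range_succ] at *
  rw [pack_append_singleton 256, pack_append_singleton 2 (fun i => (M i).toNat),
    pack_append_singleton 2 (fun j => (A m j).toNat), h1]
  simp only [List.length_range, h2, pow_add, show 9 * m = 8 * m + m by ring]
  ring

end Bits

/-- The bit of `c` at position `k`. -/
def bit (c k : ℕ) : ℕ := Nat.land (Nat.shiftRight c k) 1

theorem bit_eq (c k : ℕ) : bit c k = (c.testBit k).toNat := by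
  rw [Nat.toNat_testBit, bit]
  change (c >>> k) &&& 1 = _
  rw [Nat.and_one_is_mod, Nat.shiftRight_eq_div_pow]

/-- The code obtained from `c` by renumbering according to the list `p`. -/
def permute (c : ℕ) (p : List ℕ) : ℕ :=
  code (fun i j => bit c (Nat.add (Nat.mul 8 i) j)) (fun i => bit c (Nat.add 56 i)) p

theorem permute_matrixCode {A : ℕ → ℕ → Bool} {M : ℕ → Bool} {m : ℕ} (hm : m ≤ 7) {p : List ℕ}
    (hp : p.Perm (List.range m)) :
    permute (matrixCode A M m) p =
      matrixCode (fun i j => A (p.getD i 0) (p.getD j 0)) (fun i => M (p.getD i 0)) m := by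
  have hlen : p.length = m := by simpa using hp.length_eq
  have hmem : ∀ i ∈ p, i < m := fun i hi => List.mem_range.mp (hp.mem_iff.mp hi)
  have hpm : (List.range m).map (fun i => p.getD i 0) = p := by
    refine List.ext_getElem (by simp [hlen]) fun i h1 h2 => ?_
    simp [List.getD_eq_getElem?_getD, h2]
  have h1 : permute (matrixCode A M m) p =
      code (fun i j => (A i j).toNat) (fun i => (M i).toNat) p := by
    have e1 : pack 2 (fun i => bit (matrixCode A M m) (Nat.add 56 i)) p =
        pack 2 (fun i => (M i).toNat) p := pack_congr _ fun i hi => by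
      rw [bit_eq, Nat.add_eq, testBit_matrixCode_mask hm]
      simp [hmem i hi]
    have e2 : pack 256 (fun i => pack 2
        (fun j => bit (matrixCode A M m) (Nat.add (Nat.mul 8 i) j)) p) p =
        pack 256 (fun i => pack 2 (fun j => (A i j).toNat) p) p := pack_congr _ fun i hi =>
      pack_congr _ fun j hj => by
        have := hmem j hj
        rw [bit_eq, Nat.add_eq, Nat.mul_eq, testBit_matrixCode_row hm (hmem i hi) (by omega)]
        simp [this]
    simp only [permute, code, e1, e2]
  rw [h1]
  conv_lhs => rw [← hpm]
  simp only [matrixCode, code, pack_map]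

/-! ### Separation on codes -/

/-- Whether the rows of `c` that start at the positions in `ss`, restricted to the columns `w`, are
distinct from each other and from the rows in `seen`. -/
def distinctRows (c w : ℕ) (ss : List ℕ) : List ℕ → Bool :=
  fold (fun s ih seen => force (Nat.land (Nat.shiftRight c s) w) fun r =>
    fold (fun a jh => Bool.rec jh false (Nat.beq a r)) (ih (r :: seen)) seen) (fun _ => true) ss

/-- Whether the set of indices with the data `S` (see `indexSet`) is separated in the pattern with
the code `c`. -/
def isSeparated (c : ℕ) (S : ℕ × List ℕ) : Bool :=
  Prod.rec (fun w ss => force (Nat.lor (Nat.shiftRight c 56) w) fun w => distinctRows c w ss []) S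

/-- A set of indices, given by the bits of its complement in `0, …, m - 1` and the positions at
which its rows start. -/
def indexSet (m : ℕ) (S : List ℕ) : ℕ × List ℕ :=
  (pack 2 (fun i => (!S.elem i).toNat) (List.range m), S.map (Nat.mul 8))

theorem distinctRows_iff (c w : ℕ) (ss seen : List ℕ) :
    distinctRows c w ss seen = true ↔
      (∀ s ∈ ss, (c >>> s) &&& w ∉ seen) ∧ (ss.map fun s => (c >>> s) &&& w).Nodup := by
  induction ss generalizing seen with
  | nil => simp [distinctRows]
  | cons s ss ih =>
    have h : ∀ (r : ℕ) (b : Bool) (l : List ℕ),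
        fold (fun a jh => Bool.rec jh false (Nat.beq a r)) b l = true ↔ r ∉ l ∧ b = true := by
      intro r b l
      induction l with
      | nil => simp
      | cons a l ih =>
        rw [fold_cons]
        by_cases har : a = r
        · simp [har]
        · have : Nat.beq a r = false := by rw [← Bool.not_eq_true, Nat.beq_eq]; exact har
          rw [this]
          simp only [List.mem_cons, not_or]
          rw [ih]
          tauto
    rw [distinctRows, fold_cons, force_eq, h]
    change _ ∧ distinctRows c w ss _ = true ↔ _
    rw [ih]
    change (c >>> s) &&& w ∉ seen ∧
      (∀ s' ∈ ss, (c >>> s') &&& w ∉ ((c >>> s) &&& w) :: seen) ∧ _ ↔ _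
    simp only [List.mem_cons, not_or, List.map_cons, List.nodup_cons, List.mem_map,
      forall_eq_or_imp, not_exists, not_and]
    constructor
    · rintro ⟨h1, h2, h3⟩
      exact ⟨⟨h1, fun s' hs' => (h2 s' hs').2⟩, fun s' hs' => (h2 s' hs').1, h3⟩
    · rintro ⟨⟨h1, h2⟩, h3, h4⟩
      exact ⟨h1, fun s' hs' => ⟨h3 s' hs', h2 s' hs'⟩, h4⟩

theorem isSeparated_iff {A : ℕ → ℕ → Bool} {M : ℕ → Bool} {m : ℕ} (hm : m ≤ 7) {S : List ℕ}
    (hS : S.Nodup) (hSm : ∀ i ∈ S, i < m) :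
    isSeparated (matrixCode A M m) (indexSet m S) = true ↔
      ∀ i ∈ S, ∀ j ∈ S, i ≠ j → ∃ k < m, (M k = true ∨ k ∉ S) ∧ A i k ≠ A j k := by
  set c := matrixCode A M m with hc
  obtain ⟨w, hw⟩ : ∃ w, w = (c >>> 56) ||| (indexSet m S).1 := ⟨_, rfl⟩
  have hwk : ∀ k, w.testBit k = true ↔ k < m ∧ (M k = true ∨ k ∉ S) := by
    intro k
    rw [hw, Nat.testBit_or, Nat.testBit_shiftRight, testBit_matrixCode_mask hm, indexSet,
      testBit_pack_two]
    simp
    tauto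
  have hrow : ∀ i ∈ S, ∀ k, ((c >>> (8 * i)) &&& w).testBit k = (w.testBit k && A i k) := by
    intro i hi k
    rw [Nat.testBit_and, Nat.testBit_shiftRight]
    by_cases hk : k < m
    · rw [testBit_matrixCode_row hm (hSm i hi) (by omega)]
      simp [hk, Bool.and_comm]
    · have : w.testBit k = false := by
        rw [← Bool.not_eq_true, hwk]
        tauto
      simp [this]
  have h1 : isSeparated c (indexSet m S) = distinctRows c w (S.map (Nat.mul 8)) [] := by
    rw [hw]
    simp only [isSeparated, force_eq]
    rfl
  rw [h1, distinctRows_iff, List.map_map]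
  simp only [List.not_mem_nil, not_false_eq_true, implies_true, true_and]
  rw [List.nodup_map_iff_inj_on hS]
  refine forall₂_congr fun i hi => forall₂_congr fun j hj => ?_
  rw [← not_imp_not]
  refine imp_congr Iff.rfl ?_
  simp only [Function.comp_apply, Nat.mul_eq]
  rw [← not_iff_not, not_not]
  push Not
  constructor
  · intro h k hk hMk
    have h2 := congrArg (fun n => n.testBit k) h
    simp only [hrow i hi, hrow j hj, (hwk k).mpr ⟨hk, hMk⟩, Bool.true_and] at h2
    exact h2
  · intro h
    refine Nat.eq_of_testBit_eq fun k => ?_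
    rw [hrow i hi, hrow j hj]
    cases hb : w.testBit k with
    | false => rfl
    | true =>
      obtain ⟨hk, hMk⟩ := (hwk k).mp hb
      rw [h k hk hMk]

/-! ### The search for patterns without a separated set of four classes -/

/-- All pairs of the numbers with the digits `x 0, …, x (m - 1)` to the bases `2` and `256`, where
`x` runs through the 0-1 vectors of length `m`. -/
def vectors (m : ℕ) : List (ℕ × ℕ) :=
  Nat.rec [(0, 0)] (fun n ih =>
    fold (fun q x => force q.1 fun b => force q.2 fun s => (b, s) ::
      force (Nat.add b (Nat.pow 2 n)) fun b => force (Nat.add s (Nat.pow 256 n)) fun s =>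
        (b, s) :: x)
      [] ih) m

/-- The pairs `(i, j)` with `i < j < m`. -/
def pairs (m : ℕ) : List (ℕ × ℕ) :=
  (List.range m).flatMap fun j => (List.range j).map fun i => (i, j)

/-- Whether `i` and `j` are non-adjacent and have no common neighbour in the pattern with code
`c`. -/
def isFar (c i j : ℕ) : Bool :=
  and (Nat.beq (bit c (Nat.add (Nat.mul 8 i) j)) 0)
    (Nat.beq (Nat.land (Nat.land (Nat.shiftRight c (Nat.mul 8 i)) (Nat.shiftRight c (Nat.mul 8 j)))
      255) 0)

/-- The adjacency vectors to be tried for an additional class. If there are two non-adjacent classes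
without a common neighbour, then a common neighbour is added; otherwise, if there are two classes
that are not separated, then a class that separates them; otherwise an arbitrary class. -/
def candidates (m c : ℕ) : List (ℕ × ℕ) :=
  fold (fun p ih => Bool.rec ih
      ((vectors m).filter fun q => and (Nat.beq (bit q.1 p.1) 1) (Nat.beq (bit q.1 p.2) 1))
      (isFar c p.1 p.2))
    (fold (fun p ih => Bool.rec
        ((vectors m).filter fun q => not (Nat.beq (bit q.1 p.1) (bit q.1 p.2))) ih
        (isSeparated c (indexSet m [p.1, p.2])))
      (vectors m) (pairs m))
    (pairs m)

/-- The contributions to the code of an additional class of type (1), (N) and (K). -/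
def typeCodes (m : ℕ) : List ℕ :=
  [0, Nat.pow 2 (Nat.add 56 m), Nat.add (Nat.pow 2 (Nat.mul 9 m)) (Nat.pow 2 (Nat.add 56 m))]

/-- The code `c` of a pattern on `m` classes extended by a class with adjacency vector `q` and type
code `d`. -/
def extend (m c : ℕ) (q : ℕ × ℕ) (d : ℕ) : ℕ :=
  Nat.add
    (Nat.add c (Nat.add (Nat.mul q.1 (Nat.pow 2 (Nat.mul 8 m))) (Nat.mul q.2 (Nat.pow 2 m)))) d

/-- Whether one of the given sets is separated. -/
def anySeparated (c : ℕ) (Ss : List (ℕ × List ℕ)) : Bool :=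
  fold (fun S ih => Bool.rec ih true (isSeparated c S)) false Ss

/-- The sets of size `r` of indices below `m`. -/
def indexSets (m r : ℕ) : List (ℕ × List ℕ) :=
  ((List.range m).sublistsLen r).map (indexSet m)

/-- Adds `k` to an increasing list. -/
def insertSorted (k : ℕ) (l : List ℕ) : List ℕ :=
  List.rec [k] (fun a l ih => Bool.rec (a :: ih) (k :: a :: l) (Nat.ble k a)) l

/-- A key for ordering the classes, built from the type and the degree. -/
def sortKey (m c i : ℕ) : ℕ :=
  Nat.add (bit c (Nat.add 56 i)) (Nat.mul 2 (Nat.add (bit c (Nat.mul 9 i))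
    (Nat.mul 2 (pack 1 (fun j => bit c (Nat.add (Nat.mul 8 i) j)) (List.range m)))))

/-- The indices below `m` in the order of their keys. -/
def sortedIndices (m c : ℕ) : List ℕ :=
  (Nat.rec (motive := fun _ => List ℕ) [] (fun i ih =>
    force (Nat.add (Nat.mul 8 (sortKey m c i)) i) fun k => insertSorted k ih) m).map
      fun k => Nat.mod k 8

/-- An isomorphic copy of `c` with the classes in the order of their keys. Most isomorphic patterns
receive the same copy; the search only needs that it is some copy. -/
def normalize (m c : ℕ) : ℕ := permute c (sortedIndices m c)

/-- Adds `c` to a list unless it is there already. -/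
def insertNew (c : ℕ) (l : List ℕ) : List ℕ :=
  fold (fun a ih => Bool.rec ih l (Nat.beq a c)) (c :: l) l

/-- The patterns obtained from those in `L`, which have `m` classes, by the extensions that do not
create a separated set of four classes. -/
def next (m : ℕ) (L : List ℕ) : List ℕ :=
  fold (fun c x => fold (fun q x => fold (fun d x => force (extend m c q d) fun c' =>
    Bool.rec (force (normalize (m + 1) c') fun e => insertNew e x) x
      (anySeparated c' (indexSets (m + 1) 4))) x (typeCodes m)) x (candidates m c)) [] L

/-- Whether the pattern is reduced and has diameter at most two. -/
def isComplete (m c : ℕ) : Bool :=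
  (pairs m).all fun p => !isFar c p.1 p.2 && isSeparated c (indexSet m [p.1, p.2])

/-- Whether `c`, if reduced, of diameter at most two and with a separated set of three classes, is
isomorphic to a member of `L`. -/
def isListed (L : List ℕ) (m c : ℕ) : Bool :=
  !isComplete m c || !anySeparated c (indexSets m 3) ||
    (List.range m).permutations'.any fun p => force (permute c p) fun d => L.any (Nat.beq d)

/-- Passes on a list of numerals; see `force`. -/
def forceList {β : Type} (l : List ℕ) : (List ℕ → β) → β :=
  fold (fun a ih k => force a fun a => ih fun l => k (a :: l)) (fun k => k []) l

/-- Extends the patterns in `L`, which have `m` classes, until none is left, and checks all of them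
with `isListed`; false if a list remains after `n` rounds. -/
def search (K : ℕ → List ℕ) (n : ℕ) : ℕ → List ℕ → Bool :=
  Nat.rec (fun _ _ => false) (fun _ ih m L => forceList L fun L =>
    L.isEmpty || (L.all (isListed (K m) m) && ih (m + 1) (next m L))) n

end TwinSearch

namespace TwinPattern

variable {T : Type*} (P : TwinPattern T)

/-- The code of the pattern induced on the classes `v 0, …, v (m - 1)`. -/
def codeOn (v : ℕ → T) (m : ℕ) : ℕ :=
  TwinSearch.matrixCode (fun i j => P.adj (v i) (v j)) (fun i => P.thick (v i)) m

end TwinPattern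

namespace TwinSearch

section Lists

theorem mem_pairs {m : ℕ} {p : ℕ × ℕ} : p ∈ pairs m ↔ p.1 < p.2 ∧ p.2 < m := by
  obtain ⟨i, j⟩ := p
  simp only [pairs, List.mem_flatMap, List.mem_range, List.mem_map, Prod.mk.injEq]
  constructor
  · rintro ⟨j', hj, i', hi, rfl, rfl⟩
    exact ⟨hi, hj⟩
  · rintro ⟨h1, h2⟩
    exact ⟨j, h2, i, h1, rfl, rfl⟩

theorem mem_vectors (x : ℕ → Bool) (m : ℕ) :
    (pack 2 (fun i => (x i).toNat) (List.range m), pack 256 (fun i => (x i).toNat) (List.range m)) ∈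
      vectors m := by
  induction m with
  | zero => simp [vectors]
  | succ m ih =>
    have key : ∀ l : List (ℕ × ℕ), ∀ q ∈ l, ∀ t : Bool,
        (q.1 + 2 ^ m * t.toNat, q.2 + 256 ^ m * t.toNat) ∈
          fold (fun q x => force q.1 fun b => force q.2 fun s => (b, s) ::
            force (Nat.add b (Nat.pow 2 m)) fun b => force (Nat.add s (Nat.pow 256 m)) fun s =>
              (b, s) :: x) [] l := by
      intro l q hq t
      induction l with
      | nil => cases hq
      | cons a l ihl =>
        simp only [fold_cons, force_eq, List.mem_cons]
        rcases List.mem_cons.mp hq with rfl | hq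
        · cases t
          · left; simp
          · right; left; simp
        · simp only [force_eq] at ihl
          exact Or.inr (Or.inr (ihl hq))
    rw [List.range_succ, pack_append_singleton, pack_append_singleton, List.length_range]
    exact key _ _ ih (x m)

theorem mem_insertNew {c d : ℕ} {l : List ℕ} : d ∈ insertNew c l ↔ d = c ∨ d ∈ l := by
  have key : ∀ l', fold (fun a ih => Bool.rec ih l (Nat.beq a c)) (c :: l) l' = c :: l ∨
      c ∈ l' ∧ fold (fun a ih => Bool.rec ih l (Nat.beq a c)) (c :: l) l' = l := by
    intro l'
    induction l' with
    | nil => exact Or.inl rfl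
    | cons a l' ih =>
      rw [fold_cons]
      cases h : Nat.beq a c with
      | false =>
        rcases ih with ih | ⟨h1, ih⟩
        · exact Or.inl ih
        · exact Or.inr ⟨List.mem_cons_of_mem _ h1, ih⟩
      | true =>
        have : a = c := by simpa using h
        exact Or.inr ⟨by simp [this], rfl⟩
  rcases key l with h | ⟨h1, h⟩
  · rw [insertNew, h, List.mem_cons]
  · rw [insertNew, h]
    exact ⟨Or.inr, fun h2 => h2.elim (fun e => e ▸ h1) id⟩

/-- In a fold whose steps only add members to a list, a member added by one of the steps is present
at the end. -/
theorem mem_fold {α : Type} {f : α → List ℕ → List ℕ} (hf : ∀ a x, x ⊆ f a x) {e : ℕ} {a : α}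
    {l : List α} (ha : a ∈ l) (he : ∀ x, e ∈ f a x) (x : List ℕ) : e ∈ fold f x l := by
  induction l with
  | nil => cases ha
  | cons b l ih =>
    rw [fold_cons]
    rcases List.mem_cons.mp ha with rfl | ha
    · exact he _
    · exact hf _ _ (ih ha)

theorem subset_fold {α : Type} {f : α → List ℕ → List ℕ} (hf : ∀ a x, x ⊆ f a x) (l : List α)
    (x : List ℕ) : x ⊆ fold f x l := by
  induction l with
  | nil => exact List.Subset.refl _
  | cons a l ih => exact fun e he => hf _ _ (ih he)

/-- A fold that searches for the first member passing a test. -/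
theorem fold_first {α β : Type} {g : α → β} {test : α → Bool} {x : β} (l : List α) :
    (∃ p ∈ l, test p = true ∧ fold (fun p ih => Bool.rec ih (g p) (test p)) x l = g p) ∨
      fold (fun p ih => Bool.rec ih (g p) (test p)) x l = x := by
  induction l with
  | nil => exact Or.inr rfl
  | cons a l ih =>
    rw [fold_cons]
    cases h : test a with
    | true => exact Or.inl ⟨a, by simp, h, rfl⟩
    | false =>
      rcases ih with ⟨p, hp, h1, h2⟩ | h2
      · exact Or.inl ⟨p, by simp [hp], h1, h2⟩
      · exact Or.inr h2

/-- A fold that searches for the first member failing a test. -/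
theorem fold_first_not {α β : Type} {g : α → β} {test : α → Bool} {x : β} (l : List α) :
    (∃ p ∈ l, test p = false ∧ fold (fun p ih => Bool.rec (g p) ih (test p)) x l = g p) ∨
      fold (fun p ih => Bool.rec (g p) ih (test p)) x l = x := by
  induction l with
  | nil => exact Or.inr rfl
  | cons a l ih =>
    rw [fold_cons]
    cases h : test a with
    | false => exact Or.inl ⟨a, by simp, h, rfl⟩
    | true =>
      rcases ih with ⟨p, hp, h1, h2⟩ | h2
      · exact Or.inl ⟨p, by simp [hp], h1, h2⟩
      · exact Or.inr h2

theorem anySeparated_iff {c : ℕ} {Ss : List (ℕ × List ℕ)} :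
    anySeparated c Ss = true ↔ ∃ S ∈ Ss, isSeparated c S = true := by
  induction Ss with
  | nil => simp [anySeparated]
  | cons S Ss ih =>
    change Bool.rec (anySeparated c Ss) true (isSeparated c S) = true ↔ _
    cases h : isSeparated c S <;> simp [h, ih]

theorem insertSorted_perm (k : ℕ) (l : List ℕ) : (insertSorted k l).Perm (k :: l) := by
  induction l with
  | nil => exact List.Perm.refl _
  | cons a l ih =>
    change List.Perm (Bool.rec (a :: insertSorted k l) (k :: a :: l) (Nat.ble k a)) _
    cases Nat.ble k a with
    | false => exact (ih.cons a).trans (List.Perm.swap k a l)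
    | true => exact List.Perm.refl _

theorem sortedIndices_perm {m : ℕ} (hm : m ≤ 7) (c : ℕ) :
    (sortedIndices m c).Perm (List.range m) := by
  have h : ∀ (f : ℕ → ℕ) (n : ℕ), (Nat.rec (motive := fun _ => List ℕ) [] (fun i ih =>
      force (Nat.add (Nat.mul 8 (f i)) i) fun k => insertSorted k ih) n).Perm
      ((List.range n).map fun i => 8 * f i + i) := by
    intro f n
    induction n with
    | zero => exact List.Perm.refl _
    | succ n ih =>
      simp only [force_eq]
      rw [List.range_succ, List.map_append]
      refine (insertSorted_perm _ _).trans ?_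
      simp only [force_eq] at ih
      exact (ih.cons _).trans (List.perm_append_singleton _ _).symm
  refine ((h (sortKey m c) m).map (fun k => Nat.mod k 8)).trans ?_
  rw [List.map_map]
  refine List.Perm.of_eq ((List.map_congr_left fun i hi => ?_).trans (List.map_id _))
  have := List.mem_range.mp hi
  change (8 * sortKey m c i + i) % 8 = i
  omega

end Lists

section Soundness

variable {T : Type*} {P : TwinPattern T} {v : ℕ → T} {m : ℕ}

theorem codeOn_congr {v' : ℕ → T} (h : ∀ i < m, v i = v' i) : P.codeOn v m = P.codeOn v' m :=
  matrixCode_congr (fun i hi j hj => by rw [h i hi, h j hj]) (fun i hi => by rw [h i hi])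

theorem permute_codeOn (hm : m ≤ 7) {p : List ℕ} (hp : p.Perm (List.range m)) :
    permute (P.codeOn v m) p = P.codeOn (fun i => v (p.getD i 0)) m :=
  permute_matrixCode hm hp

theorem getD_lt_and_injOn {p : List ℕ} (hp : p.Perm (List.range m)) :
    (∀ i < m, p.getD i 0 < m) ∧ Set.InjOn (fun i => p.getD i 0) (Set.Iio m) ∧
      ∀ k < m, ∃ i < m, p.getD i 0 = k := by
  have hlen : p.length = m := by simpa using hp.length_eq
  have hnd : p.Nodup := hp.nodup_iff.mpr List.nodup_range
  subst hlen
  refine ⟨fun i hi => ?_, fun i hi j hj hij => ?_, fun k hk => ?_⟩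
  · rw [List.getD_eq_getElem _ _ hi]
    exact List.mem_range.mp (hp.mem_iff.mp (List.getElem_mem hi))
  · have hi' : i < p.length := hi
    have hj' : j < p.length := hj
    simp only [List.getD_eq_getElem _ _ hi', List.getD_eq_getElem _ _ hj'] at hij
    exact (hnd.getElem_inj_iff).mp hij
  · obtain ⟨i, hi, rfl⟩ := List.getElem_of_mem (hp.mem_iff.mpr (List.mem_range.mpr hk))
    exact ⟨i, hi, List.getD_eq_getElem _ _ hi⟩

/-- Separation in an induced pattern implies separation in the whole pattern. -/
theorem separated_of_isSeparated (hm : m ≤ 7) (hv : Set.InjOn v (Set.Iio m)) {S : List ℕ}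
    (hS : S.Nodup) (hSm : ∀ i ∈ S, i < m) (h : isSeparated (P.codeOn v m) (indexSet m S) = true) :
    P.Separated (v '' {i | i ∈ S}) := by
  rw [TwinPattern.codeOn, isSeparated_iff hm hS hSm] at h
  rintro _ ⟨i, hi, rfl⟩ _ ⟨j, hj, rfl⟩ hij
  obtain ⟨k, hk, hkS, hne⟩ := h i hi j hj (fun e => hij (e ▸ rfl))
  refine ⟨v k, hkS.imp_right ?_, hne⟩
  rintro hkS ⟨l, hl, hlk⟩
  exact hkS (hv (hSm l hl) hk hlk ▸ hl)

/-- If all classes are numbered, then separation can be read off from the code. -/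
theorem isSeparated_of_separated (hm : m ≤ 7) (hv : Set.InjOn v (Set.Iio m))
    (hsurj : ∀ y, ∃ i < m, v i = y) {S : List ℕ} (hS : S.Nodup) (hSm : ∀ i ∈ S, i < m)
    (h : P.Separated (v '' {i | i ∈ S})) : isSeparated (P.codeOn v m) (indexSet m S) = true := by
  rw [TwinPattern.codeOn, isSeparated_iff hm hS hSm]
  intro i hi j hj hij
  obtain ⟨l, hl, hne⟩ := h (v i) ⟨i, hi, rfl⟩ (v j) ⟨j, hj, rfl⟩
    (fun e => hij (hv (hSm i hi) (hSm j hj) e))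
  obtain ⟨k, hk, rfl⟩ := hsurj l
  exact ⟨k, hk, hl.imp_right fun h hk => h ⟨k, hk, rfl⟩, hne⟩

theorem anySeparated_indexSets (hm : m ≤ 7) (hv : Set.InjOn v (Set.Iio m)) {r : ℕ}
    (h : anySeparated (P.codeOn v m) (indexSets m r) = true) :
    ∃ S : Finset T, S.card = r ∧ P.Separated S := by
  classical
  obtain ⟨_, hmem, hsep⟩ := anySeparated_iff.mp h
  obtain ⟨S, hS, rfl⟩ := List.mem_map.mp hmem
  obtain ⟨hsub, hlen⟩ := List.mem_sublistsLen.mp hS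
  have hnd : S.Nodup := hsub.nodup List.nodup_range
  have hlt : ∀ i ∈ S, i < m := fun i hi => List.mem_range.mp (hsub.subset hi)
  refine ⟨S.toFinset.image v, ?_, ?_⟩
  · rw [Finset.card_image_of_injOn, List.toFinset_card_of_nodup hnd, hlen]
    exact hv.mono fun i hi => hlt i (by simpa using hi)
  · convert separated_of_isSeparated hm hv hnd hlt hsep
    ext; simp

theorem anySeparated_of_exists (hm : m ≤ 7) (hv : Set.InjOn v (Set.Iio m))
    (hsurj : ∀ y, ∃ i < m, v i = y) {r : ℕ} (h : ∃ S : Finset T, S.card = r ∧ P.Separated S) :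
    anySeparated (P.codeOn v m) (indexSets m r) = true := by
  classical
  obtain ⟨S, hr, hS⟩ := h
  obtain ⟨l, hl⟩ : ∃ l, l = (List.range m).filter fun i => decide (v i ∈ S) := ⟨_, rfl⟩
  have hsub : l.Sublist (List.range m) := hl ▸ List.filter_sublist
  have hnd : l.Nodup := hsub.nodup List.nodup_range
  have hlt : ∀ i ∈ l, i < m := fun i hi => List.mem_range.mp (hsub.subset hi)
  have himg : v '' {i | i ∈ l} = S := by
    ext y
    simp only [hl, List.mem_filter, List.mem_range, decide_eq_true_eq, Set.mem_image,
      Set.mem_ofPred_eq, Finset.mem_coe]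
    constructor
    · rintro ⟨i, ⟨_, h⟩, rfl⟩
      exact h
    · intro hy
      obtain ⟨i, hi, rfl⟩ := hsurj y
      exact ⟨i, ⟨hi, hy⟩, rfl⟩
  refine anySeparated_iff.mpr ⟨indexSet m l, List.mem_map.mpr ⟨l, ?_, rfl⟩, ?_⟩
  · refine List.mem_sublistsLen.mpr ⟨hsub, ?_⟩
    have hcard : (l.toFinset.image v).card = l.toFinset.card :=
      Finset.card_image_of_injOn (hv.mono fun i hi => hlt i (by simpa using hi))
    rw [← List.toFinset_card_of_nodup hnd, ← hcard, ← hr]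
    congr 1
    rw [← Finset.coe_inj, ← himg]
    ext; simp
  · exact isSeparated_of_separated hm hv hsurj hnd hlt (himg ▸ hS)

theorem adj_of_isFar (hm : m ≤ 7) {i j : ℕ} (hi : i < m) (hj : j < m)
    (h : isFar (P.codeOn v m) i j = true) :
    P.adj (v i) (v j) = false ∧
      ∀ k < m, ¬ (P.adj (v i) (v k) = true ∧ P.adj (v j) (v k) = true) := by
  rw [isFar, Bool.and_eq_true, Nat.beq_eq, Nat.beq_eq] at h
  obtain ⟨h1, h2⟩ := h
  constructor
  · rw [bit_eq, Nat.add_eq, Nat.mul_eq, TwinPattern.codeOn,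
      testBit_matrixCode_row hm hi (by omega)] at h1
    simpa [hj] using h1
  · rintro k hk ⟨h3, h4⟩
    have h5 : ((P.codeOn v m >>> (8 * i)) &&& (P.codeOn v m >>> (8 * j)) &&& 255).testBit k =
        false := by
      have := congrArg (fun n => n.testBit k) h2
      simpa using this
    rw [show 255 = 2 ^ 8 - 1 from rfl, Nat.testBit_and, Nat.testBit_and, Nat.testBit_shiftRight,
      Nat.testBit_shiftRight, Nat.testBit_two_pow_sub_one, TwinPattern.codeOn,
      testBit_matrixCode_row hm hi (by omega), testBit_matrixCode_row hm hj (by omega)] at h5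
    have h6 : k < 8 := by omega
    simp [h3, h4, hk, h6] at h5

/-- A class that separates `v i` and `v j`, if these are not separated among `v 0, …, v (m - 1)`, is
not among these classes itself. -/
theorem not_mem_of_not_isSeparated (hm : m ≤ 7) {i j : ℕ} (hi : i < m)
    (hj : j < m) (hij : i ≠ j)
    (h : isSeparated (P.codeOn v m) (indexSet m [i, j]) = false) {l : T}
    (hl : P.thick l = true ∨ l ∉ ({v i, v j} : Set T)) (hne : P.adj (v i) l ≠ P.adj (v j) l) :
    ∀ k < m, v k ≠ l := by
  rintro k hk rfl
  rw [← Bool.not_eq_true, TwinPattern.codeOn, isSeparated_iff hm (by simp [hij])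
    (by simp [hi, hj])] at h
  have hk' : P.thick (v k) = true ∨ k ∉ [i, j] := hl.imp_right fun h hk => h (by
    simp only [List.mem_cons, List.not_mem_nil, or_false] at hk
    rcases hk with rfl | rfl <;> simp)
  refine h fun a ha b hb hab => ⟨k, hk, hk', ?_⟩
  simp only [List.mem_cons, List.not_mem_nil, or_false] at ha hb
  rcases ha with rfl | rfl <;> rcases hb with rfl | rfl
  · exact absurd rfl hab
  · exact hne
  · exact hne.symm
  · exact absurd rfl hab

/-- The adjacency vector, in the two encodings, of a class to the classes `v 0, …, v (m - 1)`. -/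
def vectorOf (P : TwinPattern T) (v : ℕ → T) (m : ℕ) (y : T) : ℕ × ℕ :=
  (pack 2 (fun i => (P.adj y (v i)).toNat) (List.range m),
    pack 256 (fun i => (P.adj y (v i)).toNat) (List.range m))

theorem bit_vectorOf {y : T} {i : ℕ} (hi : i < m) :
    bit (vectorOf P v m y).1 i = (P.adj (v i) y).toNat := by
  rw [bit_eq, vectorOf, testBit_pack_two, P.adj_comm y]
  simp [hi]

/-- As long as there are further classes, one of them has its adjacency vector among the
candidates. -/
theorem exists_vectorOf_mem_candidates (hm : m ≤ 7) (hv : Set.InjOn v (Set.Iio m))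
    (hred : P.Reduced) (hdiam : P.DiamTwo) (hy : ∃ y, ∀ i < m, v i ≠ y) :
    ∃ y, (∀ i < m, v i ≠ y) ∧ vectorOf P v m y ∈ candidates m (P.codeOn v m) := by
  have hne : ∀ p ∈ pairs m, p.1 < m ∧ p.2 < m ∧ p.1 ≠ p.2 ∧ v p.1 ≠ v p.2 := by
    intro p hp
    have h := mem_pairs.mp hp
    exact ⟨h.1.trans h.2, h.2, h.1.ne, fun e => h.1.ne (hv (h.1.trans h.2) h.2 e)⟩
  rw [candidates]
  rcases fold_first (test := fun p : ℕ × ℕ => isFar (P.codeOn v m) p.1 p.2) (pairs m) with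
    ⟨p, hp, hfar, h⟩ | h
  · rw [h]
    obtain ⟨hi, hj, -, hvne⟩ := hne p hp
    obtain ⟨hadj, hcommon⟩ := adj_of_isFar hm hi hj hfar
    obtain ⟨l, h1, h2⟩ := hdiam _ _ hvne hadj
    refine ⟨l, ?_, List.mem_filter.mpr ⟨mem_vectors _ m, ?_⟩⟩
    · rintro k hk rfl
      exact hcommon k hk ⟨h1, h2⟩
    · rw [bit_vectorOf hi, bit_vectorOf hj, h1, h2]
      rfl
  rw [h]
  rcases fold_first_not (test := fun p : ℕ × ℕ =>
    isSeparated (P.codeOn v m) (indexSet m [p.1, p.2])) (pairs m) with ⟨p, hp, hsep, h⟩ | h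
  · rw [h]
    obtain ⟨hi, hj, hij, hvne⟩ := hne p hp
    obtain ⟨l, hl, hln⟩ := hred _ _ hvne (v p.1) (by simp) (v p.2) (by simp) hvne
    refine ⟨l, not_mem_of_not_isSeparated hm hi hj hij hsep hl hln,
      List.mem_filter.mpr ⟨mem_vectors _ m, ?_⟩⟩
    rw [bit_vectorOf hi, bit_vectorOf hj]
    revert hln
    cases P.adj (v p.1) l <;> cases P.adj (v p.2) l <;> simp [Nat.beq]
  · rw [h]
    obtain ⟨y, hy⟩ := hy
    exact ⟨y, hy, mem_vectors _ m⟩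

theorem codeOn_update (y : T) :
    ∃ d ∈ typeCodes m, P.codeOn (Function.update v m y) (m + 1) =
      extend m (P.codeOn v m) (vectorOf P v m y) d := by
  have hlt : ∀ i < m, Function.update v m y i = v i := fun i hi => Function.update_of_ne hi.ne _ _
  have h1 : P.codeOn (Function.update v m y) m = P.codeOn v m := codeOn_congr hlt
  have h2 : ∀ q, pack q (fun j => (P.adj y (Function.update v m y j)).toNat) (List.range m) =
      pack q (fun j => (P.adj y (v j)).toNat) (List.range m) := fun q =>
    pack_congr q fun j hj => by rw [hlt j (List.mem_range.mp hj)]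
  have h3 : P.codeOn (Function.update v m y) (m + 1) =
      extend m (P.codeOn v m) (vectorOf P v m y)
        ((P.adj y y).toNat * 2 ^ (9 * m) + (P.thick y).toNat * 2 ^ (56 + m)) := by
    rw [TwinPattern.codeOn, matrixCode_succ (fun i _ => P.adj_comm _ _)]
    change P.codeOn (Function.update v m y) m + _ + _ = _
    rw [h1, Function.update_self, h2, h2]
    rfl
  refine ⟨_, ?_, h3⟩
  have h4 := P.thick_of_adj_self y
  cases ha : P.adj y y
  · cases ht : P.thick y <;> simp [typeCodes]
  · rw [h4 ha]
    simp [typeCodes]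

theorem mem_next {c : ℕ} {L : List ℕ} {q : ℕ × ℕ} {d : ℕ} (hc : c ∈ L) (hq : q ∈ candidates m c)
    (hd : d ∈ typeCodes m)
    (h : anySeparated (extend m c q d) (indexSets (m + 1) 4) = false) :
    normalize (m + 1) (extend m c q d) ∈ next m L := by
  have h3 : ∀ c q d x, x ⊆ (force (extend m c q d) fun c' =>
      Bool.rec (force (normalize (m + 1) c') fun e => insertNew e x) x
        (anySeparated c' (indexSets (m + 1) 4)) : List ℕ) := by
    intro c q d x
    rw [force_eq]
    cases anySeparated (extend m c q d) (indexSets (m + 1) 4) with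
    | true => exact List.Subset.refl _
    | false =>
      intro e he
      simp only [force_eq]
      exact mem_insertNew.mpr (Or.inr he)
  refine mem_fold (fun c x => subset_fold (fun q x => subset_fold (h3 c q) _ _) _ _) hc
    (fun x => ?_) _
  refine mem_fold (fun q x => subset_fold (h3 c q) _ _) hq (fun x => ?_) _
  refine mem_fold (h3 c q) hd (fun x => ?_) _
  rw [force_eq, h]
  simp only [force_eq]
  exact mem_insertNew.mpr (Or.inl rfl)

/-- One step of the search: unless the classes `v 0, …, v (m - 1)` are all, the next list contains
the code of the pattern on some `m + 1` classes. -/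
theorem exists_codeOn_mem_next (hm : m < 7) (hv : Set.InjOn v (Set.Iio m))
    (hred : P.Reduced) (hdiam : P.DiamTwo)
    (h4 : ¬ ∃ S : Finset T, S.card = 4 ∧ P.Separated S) {L : List ℕ} (hL : P.codeOn v m ∈ L)
    (hy : ∃ y, ∀ i < m, v i ≠ y) :
    ∃ w : ℕ → T, Set.InjOn w (Set.Iio (m + 1)) ∧ P.codeOn w (m + 1) ∈ next m L := by
  obtain ⟨y, hy, hcand⟩ := exists_vectorOf_mem_candidates hm.le hv hred hdiam hy
  have hinj : Set.InjOn (Function.update v m y) (Set.Iio (m + 1)) := by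
    have hlt : ∀ i < m, Function.update v m y i = v i :=
      fun i hi => Function.update_of_ne hi.ne _ _
    intro i hi j hj hij
    rcases Nat.lt_succ_iff_lt_or_eq.mp hi with hi | rfl <;>
      rcases Nat.lt_succ_iff_lt_or_eq.mp hj with hj | rfl
    · rw [hlt i hi, hlt j hj] at hij
      exact hv hi hj hij
    · rw [hlt i hi, Function.update_self] at hij
      exact absurd hij (hy i hi)
    · rw [hlt j hj, Function.update_self] at hij
      exact absurd hij.symm (hy j hj)
    · rfl
  obtain ⟨d, hd, hcode⟩ := codeOn_update (P := P) (v := v) (m := m) y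
  have hsep : anySeparated (extend m (P.codeOn v m) (vectorOf P v m y) d) (indexSets (m + 1) 4) =
      false := by
    rw [← Bool.not_eq_true, ← hcode]
    exact fun h => h4 (anySeparated_indexSets hm hinj h)
  have hp := sortedIndices_perm (m := m + 1) hm (extend m (P.codeOn v m) (vectorOf P v m y) d)
  obtain ⟨hlt, hpinj, -⟩ := getD_lt_and_injOn hp
  have hmem := mem_next hL hcand hd hsep
  rw [normalize, ← hcode, permute_codeOn hm (hcode ▸ hp), hcode] at hmem
  exact ⟨_, hinj.comp hpinj hlt, hmem⟩

theorem forceList_eq {β : Type} (l : List ℕ) (k : List ℕ → β) : forceList l k = k l := by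
  induction l generalizing k with
  | nil => rfl
  | cons a l ih =>
    change force a (fun a => forceList l fun l => k (a :: l)) = _
    rw [force_eq, ih]

/-- A successful search lists all patterns: a reduced pattern of diameter two without a separated
set of four classes, but with one of three, has its code, for some numbering of its classes, among
the given codes. -/
theorem exists_codeOn_mem_of_search [Finite T] (hred : P.Reduced) (hdiam : P.DiamTwo)
    (h3 : ∃ S : Finset T, S.card = 3 ∧ P.Separated S)
    (h4 : ¬ ∃ S : Finset T, S.card = 4 ∧ P.Separated S) {K : ℕ → List ℕ} {n : ℕ} {L : List ℕ}
    (hmn : m + n ≤ 8) (hv : Set.InjOn v (Set.Iio m)) (hL : P.codeOn v m ∈ L)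
    (hsearch : search K n m L = true) :
    ∃ k ≤ 7, ∃ w : ℕ → T, Set.InjOn w (Set.Iio k) ∧ (∀ y, ∃ i < k, w i = y) ∧
      P.codeOn w k ∈ K k := by
  induction n generalizing m v L with
  | zero => cases hsearch
  | succ n ih =>
    change (forceList L fun L => L.isEmpty || (L.all (isListed (K m) m) &&
      search K n (m + 1) (next m L))) = true at hsearch
    rw [forceList_eq, Bool.or_eq_true, Bool.and_eq_true] at hsearch
    have hne : L.isEmpty = false := by
      rw [List.isEmpty_eq_false_iff]
      exact List.ne_nil_of_mem hL
    rw [hne] at hsearch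
    obtain ⟨hall, hnext⟩ := hsearch.resolve_left (by simp)
    by_cases hy : ∃ y, ∀ i < m, v i ≠ y
    · cases n with
      | zero => cases hnext
      | succ n =>
        obtain ⟨w, hw, hwL⟩ := exists_codeOn_mem_next (by omega) hv hred hdiam h4 hL hy
        exact ih (by omega) hw hwL hnext
    · push Not at hy
      have hm : m ≤ 7 := by omega
      have hlisted := List.all_eq_true.mp hall _ hL
      have hcomplete : isComplete m (P.codeOn v m) = true := by
        rw [isComplete, List.all_eq_true]
        intro p hp
        obtain ⟨hij, hj⟩ := mem_pairs.mp hp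
        have hi := hij.trans hj
        have hvne : v p.1 ≠ v p.2 := fun e => hij.ne (hv hi hj e)
        rw [Bool.and_eq_true, Bool.not_eq_true']
        constructor
        · rw [← Bool.not_eq_true]
          intro hfar
          obtain ⟨hadj, hcommon⟩ := adj_of_isFar hm hi hj hfar
          obtain ⟨l, hl⟩ := hdiam _ _ hvne hadj
          obtain ⟨k, hk, rfl⟩ := hy l
          exact hcommon k hk hl
        · by_contra hsep
          rw [Bool.not_eq_true] at hsep
          obtain ⟨l, hl, hln⟩ := hred _ _ hvne (v p.1) (by simp) (v p.2) (by simp) hvne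
          obtain ⟨k, hk, hkl⟩ := hy l
          exact not_mem_of_not_isSeparated hm hi hj hij.ne hsep hl hln k hk hkl
      rw [isListed, hcomplete, anySeparated_of_exists hm hv hy h3] at hlisted
      simp only [Bool.not_true, Bool.or_self, Bool.false_or, List.any_eq_true, force_eq] at hlisted
      obtain ⟨p, hp, d, hd, hpd⟩ := hlisted
      rw [List.mem_permutations'] at hp
      obtain ⟨hlt, hpinj, hpsurj⟩ := getD_lt_and_injOn hp
      refine ⟨m, hm, fun i => v (p.getD i 0), hv.comp hpinj hlt, fun y => ?_, ?_⟩
      · obtain ⟨k, hk, rfl⟩ := hy y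
        obtain ⟨i, hi, rfl⟩ := hpsurj k hk
        exact ⟨i, hi, rfl⟩
      · rw [← permute_codeOn hm hp, (Nat.beq_eq ▸ hpd : permute (P.codeOn v m) p = d)]
        exact hd

end Soundness

/-! ### The ten structures -/

/-- The types (1), (K) and (N) of a twin class. -/
inductive Kind
  | single
  | clique
  | coclique

namespace Kind

/-- Whether the type is (1). -/
def isSingle : Kind → Bool
  | single => true
  | _ => false

/-- Whether the type is (K). -/
def isClique : Kind → Bool
  | clique => true
  | _ => false

/-- Whether the type is (N). -/
def isCoclique : Kind → Bool
  | coclique => true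
  | _ => false

end Kind

/-- All lists of kinds of length `m`. -/
def kindLists (m : ℕ) : List (List Kind) :=
  Nat.rec [[]] (fun _ ih => ih.flatMap fun l =>
    [Kind.single :: l, Kind.clique :: l, Kind.coclique :: l]) m

/-- A graph on `0, …, order - 1`, given by a list of edges, and a condition on the types of its
vertices. -/
structure Shape where
  order : ℕ
  edges : List (ℕ × ℕ)
  cond : List Kind → Bool

namespace Shape

/-- Whether `i` and `j` are joined by an edge. -/
def edge (s : Shape) (i j : ℕ) : Bool :=
  s.edges.any fun e => (Nat.beq e.1 i && Nat.beq e.2 j) || (Nat.beq e.1 j && Nat.beq e.2 i)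

/-- The adjacency matrix of the graph with the given types, with diagonal entries as in
`TwinPattern`. -/
def matrix (s : Shape) (t : List Kind) (i j : ℕ) : Bool :=
  bif Nat.beq i j then (t.getD i Kind.single).isClique else s.edge i j

/-- Whether the `i`-th type is different from (1). -/
def thick (t : List Kind) (i : ℕ) : Bool := !(t.getD i Kind.single).isSingle

/-- The codes of all patterns with this shape. -/
def codes (s : Shape) : List ℕ :=
  ((kindLists s.order).filter s.cond).map fun t => matrixCode (s.matrix t) (thick t) s.order

end Shape

open Kind

/-- The shape of `SimpleGraph.StructureG1`. -/
def shapeG1 : Shape where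
  order := 3
  edges := [(0, 1), (0, 2), (1, 2)]
  cond
    | [a, b, c] => (isCoclique a && isCoclique b) || (isCoclique a && isCoclique c) ||
        (isCoclique b && isCoclique c)
    | _ => false

/-- The shape of `SimpleGraph.StructureG2`. -/
def shapeG2 : Shape where
  order := 3
  edges := [(0, 1), (1, 2)]
  cond
    | [a, b, c] => (isCoclique b && (isClique a || isClique c)) ||
        ((isClique a && !isSingle c) || (isClique c && !isSingle a))
    | _ => false

/-- The shape of `SimpleGraph.StructureG3`. -/
def shapeG3 : Shape where
  order := 4
  edges := [(0, 1), (0, 2), (1, 2), (0, 3)]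
  cond
    | [a, b, c, d] => ((isCoclique b && !isCoclique c) || (isCoclique c && !isCoclique b)) &&
        !isClique d && (!(isClique b || isClique c) || (!isCoclique d && !isCoclique a))
    | _ => false

/-- The shape of `SimpleGraph.StructureG4`. -/
def shapeG4 : Shape where
  order := 5
  edges := [(0, 1), (1, 2), (2, 3), (3, 4), (4, 0)]
  cond
    | [a, b, c, d, e] => isSingle a && isSingle b && isSingle c && isSingle d && isSingle e
    | _ => false

/-- The shape of `SimpleGraph.StructureG5`. -/
def shapeG5 : Shape where
  order := 5
  edges := [(0, 1), (1, 2), (2, 3), (3, 4), (4, 0), (0, 2)]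
  cond
    | [a, b, c, d, e] => isSingle d && isSingle e && !isCoclique a && !isCoclique b && !isCoclique c
    | _ => false

/-- The shape of `SimpleGraph.StructureG6`. -/
def shapeG6 : Shape where
  order := 5
  edges := [(0, 1), (1, 2), (2, 3), (3, 4), (4, 0), (0, 2), (0, 3)]
  cond
    | [a, b, c, d, e] => !isCoclique b && !isCoclique c && !isCoclique d && !isCoclique e &&
        !(isClique b && isClique d) && !(isClique b && isClique e) && !(isClique c && isClique e) &&
        !(isCoclique a && (isClique b || isClique c || isClique d || isClique e))
    | _ => false

/-- The shape of `SimpleGraph.StructureG7`. -/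
def shapeG7 : Shape where
  order := 5
  edges := [(0, 1), (0, 2), (0, 3), (1, 2), (1, 3), (0, 4)]
  cond
    | [a, b, c, d, e] => isSingle e && !isCoclique a && !isCoclique b &&
        ((isClique c && isSingle d) || (isClique d && isSingle c))
    | _ => false

/-- The shape of `SimpleGraph.StructureG8`. -/
def shapeG8 : Shape where
  order := 4
  edges := [(0, 1), (0, 2), (0, 3), (1, 2), (1, 3)]
  cond
    | [a, b, c, d] => ((isClique c && isSingle d) || (isClique d && isSingle c)) &&
        ((isCoclique a && !isCoclique b) || (isCoclique b && !isCoclique a))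
    | _ => false

/-- The shape of `SimpleGraph.StructureG9`. -/
def shapeG9 : Shape where
  order := 4
  edges := [(0, 1), (1, 2), (2, 3), (3, 0)]
  cond
    | [a, b, c, d] => isClique a && isClique b && isSingle c && isSingle d
    | _ => false

/-- The shape of `SimpleGraph.StructureG10`. -/
def shapeG10 : Shape where
  order := 5
  edges := [(0, 1), (1, 2), (2, 3), (3, 0), (4, 0), (4, 1), (4, 2), (4, 3)]
  cond
    | [a, b, c, d, e] => isClique a && isClique b && isSingle c && isSingle d && !isCoclique e
    | _ => false

/-- The shapes described by the ten structures. -/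
def shapes : List Shape :=
  [shapeG1, shapeG2, shapeG3, shapeG4, shapeG5, shapeG6, shapeG7, shapeG8, shapeG9, shapeG10]

/-- The codes of the patterns on `m` classes with one of the ten structures. -/
def shapeCodes (m : ℕ) : List ℕ := (shapes.filter fun s => Nat.beq s.order m).flatMap Shape.codes

-- The two evaluations have to be done by the kernel: the second one goes through some twenty
-- thousand extensions of patterns.

/-- Every pattern with one of the ten structures has a separated set of three classes, and none of
four. -/
theorem shapes_check : (shapes.all fun s => s.codes.all fun c =>
    anySeparated c (indexSets s.order 3) && !anySeparated c (indexSets s.order 4)) = true := by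
  decide +kernel

/-- Starting from the empty pattern, the search comes to an end before it reaches seven classes, and
every pattern that it meets passes `isListed`. -/
theorem search_check : search shapeCodes 8 0 [0] = true := by
  decide +kernel

end TwinSearch

/-! ### From shapes to structures -/

namespace TwinPattern

variable {T : Type*} (P : TwinPattern T)

open TwinSearch

/-- The type of a class. -/
def kind (a : T) : Kind :=
  bif P.thick a then bif P.adj a a then Kind.clique else Kind.coclique else Kind.single

theorem isClique_kind (a : T) : (P.kind a).isClique = P.adj a a := by
  have := P.thick_of_adj_self a
  unfold kind
  cases h : P.adj a a
  · cases P.thick a <;> rfl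
  · rw [this h]
    rfl

theorem isSingle_kind (a : T) : (P.kind a).isSingle = !P.thick a := by
  unfold kind
  cases P.thick a <;> cases P.adj a a <;> rfl

theorem isCoclique_kind (a : T) : (P.kind a).isCoclique = (P.thick a && !P.adj a a) := by
  unfold kind
  cases P.thick a <;> cases P.adj a a <;> rfl

end TwinPattern

namespace TwinSearch

theorem Kind.ext_of_eq {k l : Kind} (h1 : k.isClique = l.isClique)
    (h2 : (!k.isSingle) = !l.isSingle) : k = l := by
  cases k <;> cases l <;> simp_all [isClique, isSingle]

theorem mem_kindLists {m : ℕ} {t : List Kind} : t ∈ kindLists m ↔ t.length = m := by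
  induction m generalizing t with
  | zero => simp [kindLists]
  | succ m ih =>
    change t ∈ (kindLists m).flatMap _ ↔ _
    rw [List.mem_flatMap]
    constructor
    · rintro ⟨l, hl, ht⟩
      have := ih.mp hl
      simp only [List.mem_cons, List.not_mem_nil, or_false] at ht
      rcases ht with rfl | rfl | rfl <;> simp [this]
    · intro ht
      cases t with
      | nil => cases ht
      | cons k l =>
        refine ⟨l, ih.mpr (by simpa using ht), ?_⟩
        cases k <;> simp

/-- The classes of `P` can be numbered such that `P` gets one of the codes of the shape `s`. -/
def Shape.Fits {T : Type*} (s : Shape) (P : TwinPattern T) : Prop :=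
  ∃ w : ℕ → T, Set.InjOn w (Set.Iio s.order) ∧ (∀ y, ∃ i < s.order, w i = y) ∧
    P.codeOn w s.order ∈ s.codes

/-- A numbering realizes a shape with the types `t` if it respects adjacency and types. -/
theorem codeOn_eq_iff {T : Type*} {P : TwinPattern T} {w : ℕ → T} {s : Shape} {t : List Kind}
    (hs : s.order ≤ 7) :
    P.codeOn w s.order = matrixCode (s.matrix t) (Shape.thick t) s.order ↔
      (∀ i < s.order, ∀ j < s.order, i ≠ j → P.adj (w i) (w j) = s.edge i j) ∧
        ∀ i < s.order, P.kind (w i) = t.getD i Kind.single := by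
  have hbeq : ∀ {i j : ℕ}, i ≠ j → Nat.beq i j = false := fun h => by
    rw [← Bool.not_eq_true, Nat.beq_eq]
    exact h
  have hself : ∀ i, s.matrix t i i = (t.getD i Kind.single).isClique := fun i => by
    rw [Shape.matrix, Nat.beq_refl]
    rfl
  constructor
  · intro h
    obtain ⟨h1, h2⟩ := matrixCode_inj hs h
    refine ⟨fun i hi j hj hij => ?_, fun i hi => Kind.ext_of_eq ?_ ?_⟩
    · rw [h1 i hi j hj, Shape.matrix, hbeq hij]
      rfl
    · rw [P.isClique_kind, h1 i hi i hi, hself]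
    · rw [P.isSingle_kind, Bool.not_not, h2 i hi, Shape.thick]
  · rintro ⟨h1, h2⟩
    refine matrixCode_congr (fun i hi j hj => ?_) fun i hi => ?_
    · by_cases hij : i = j
      · subst hij
        rw [hself, ← h2 i hi, P.isClique_kind]
      · rw [h1 i hi j hj hij, Shape.matrix, hbeq hij]
        rfl
    · rw [Shape.thick, ← h2 i hi, P.isSingle_kind, Bool.not_not]

/-- Fitting a shape means that its graph is isomorphic to the twin graph, with the types as
required. -/
theorem Shape.fits_iff {V : Type*} {G : SimpleGraph V} [Nonempty V] {s : Shape} {n : ℕ}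
    (hs : s.order = n) (hn : n ≤ 7) (H : SimpleGraph (Fin n))
    (hH : ∀ i j : Fin n, H.Adj i j ↔ i ≠ j ∧ s.edge i j = true) :
    s.Fits G.twinPattern ↔
      ∃ e : H ≃g G.twinGraph, s.cond (List.ofFn fun i => G.twinPattern.kind (e i)) = true := by
  subst hs
  constructor
  · rintro ⟨w, hw, hsurj, hcode⟩
    obtain ⟨t, ht, hcode⟩ := List.mem_map.mp hcode
    obtain ⟨ht, hcond⟩ := List.mem_filter.mp ht
    have hlen := mem_kindLists.mp ht
    obtain ⟨hadj, hkind⟩ := (codeOn_eq_iff hn).mp hcode.symm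
    have hbij : Function.Bijective fun i : Fin s.order => w i := by
      refine ⟨fun i j hij => Fin.ext (hw i.2 j.2 hij), fun y => ?_⟩
      obtain ⟨i, hi, rfl⟩ := hsurj y
      exact ⟨⟨i, hi⟩, rfl⟩
    have hl : (List.ofFn fun i : Fin s.order => G.twinPattern.kind (w i)) = t := by
      refine List.ext_getElem (by simp [hlen]) fun i h1 h2 => ?_
      rw [List.getElem_ofFn, hkind i (hlen ▸ h2), List.getD_eq_getElem _ _ h2]
    refine ⟨⟨Equiv.ofBijective _ hbij, ?_⟩, ?_⟩
    · intro i j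
      change G.twinGraph.Adj (w i) (w j) ↔ _
      rw [hH]
      by_cases hij : i = j
      · simp [hij]
      · have hne : w i ≠ w j := fun e => hij (hbij.1 e)
        rw [← G.twinPattern_adj_of_ne hne, hadj i i.2 j j.2 (fun e => hij (Fin.ext e))]
        simp [hij]
    · exact (congrArg s.cond hl).trans hcond
  · rintro ⟨e, hcond⟩
    have : Nonempty G.TwinClass := ⟨G.twinClassOf (Classical.arbitrary V)⟩
    obtain ⟨w, hw⟩ : ∃ w : ℕ → G.TwinClass, ∀ i : Fin s.order, w i = e i :=
      ⟨fun i => if h : i < s.order then e ⟨i, h⟩ else Classical.arbitrary _, fun i => by simp⟩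
    have hinj : Set.InjOn w (Set.Iio s.order) := by
      intro i hi j hj hij
      have h : e ⟨i, hi⟩ = e ⟨j, hj⟩ := by rw [← hw, ← hw]; exact hij
      exact congrArg Fin.val (e.injective h)
    refine ⟨w, hinj, fun y => ⟨e.symm y, (e.symm y).2, by rw [hw]; simp⟩, ?_⟩
    refine List.mem_map.mpr ⟨_, List.mem_filter.mpr ⟨mem_kindLists.mpr (by simp), hcond⟩,
      ((codeOn_eq_iff hn).mpr ⟨fun i hi j hj hij => ?_, fun i hi => ?_⟩).symm⟩
    · have hne : e ⟨i, hi⟩ ≠ e ⟨j, hj⟩ := fun h => hij (congrArg Fin.val (e.injective h))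
      rw [hw ⟨i, hi⟩, hw ⟨j, hj⟩, Bool.eq_iff_iff, G.twinPattern_adj_of_ne hne,
        e.map_adj_iff, hH]
      simp [hij]
    · rw [hw ⟨i, hi⟩, List.getD_eq_getElem _ _ (by simpa using hi)]
      simp

end TwinSearch

namespace SimpleGraph

open TwinSearch

section Structures

variable {V : Type*} (G : SimpleGraph V)

theorem isTypeK_iff_kind (a : G.TwinClass) :
    G.IsTypeK a ↔ (G.twinPattern.kind a).isClique = true := by
  rw [TwinPattern.isClique_kind, twinPattern_adj_self]

variable [Finite V]

theorem isType1_iff_kind (a : G.TwinClass) :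
    G.IsType1 a ↔ (G.twinPattern.kind a).isSingle = true := by
  rw [TwinPattern.isSingle_kind, Bool.not_eq_true', ← Bool.not_eq_true, twinPattern_thick,
    isType1_iff]

theorem isTypeN_iff_kind (a : G.TwinClass) :
    G.IsTypeN a ↔ (G.twinPattern.kind a).isCoclique = true := by
  rw [TwinPattern.isCoclique_kind, Bool.and_eq_true, Bool.not_eq_true', ← Bool.not_eq_true,
    twinPattern_thick, twinPattern_adj_self, isTypeN_iff]

theorem isType1K_iff_kind (a : G.TwinClass) :
    G.IsType1K a ↔ (G.twinPattern.kind a).isCoclique = false := by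
  rw [IsType1K, isType1_iff_kind, isTypeK_iff_kind]
  cases G.twinPattern.kind a <;> simp [Kind.isSingle, Kind.isClique, Kind.isCoclique]

theorem isType1N_iff_kind (a : G.TwinClass) :
    G.IsType1N a ↔ (G.twinPattern.kind a).isClique = false := by
  rw [IsType1N, isType1_iff_kind, isTypeN_iff_kind]
  cases G.twinPattern.kind a <;> simp [Kind.isSingle, Kind.isClique, Kind.isCoclique]

theorem isTypeKN_iff_kind (a : G.TwinClass) :
    G.IsTypeKN a ↔ (G.twinPattern.kind a).isSingle = false := by
  rw [IsTypeKN, isTypeK_iff_kind, isTypeN_iff_kind]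
  cases G.twinPattern.kind a <;> simp [Kind.isSingle, Kind.isClique, Kind.isCoclique]

variable [Nonempty V]

theorem structureG1_iff : G.StructureG1 ↔ shapeG1.Fits G.twinPattern := by
  rw [Shape.fits_iff (n := 3) rfl (by decide) (completeGraph (Fin 3)) (by decide)]
  have key : ∀ e : completeGraph (Fin 3) ≃g G.twinGraph,
      (∀ a b : G.TwinClass, G.IsType1K a → G.IsType1K b → a = b) ↔
        shapeG1.cond (List.ofFn fun i => G.twinPattern.kind (e i)) = true := by
    intro e
    rw [e.surjective.forall₂]
    simp only [e.injective.eq_iff, isType1K_iff_kind, Fin.forall_fin_succ, List.ofFn_succ]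
    simp [shapeG1]
    cases (G.twinPattern.kind (e 0)).isCoclique <;> cases (G.twinPattern.kind (e 1)).isCoclique <;>
      cases (G.twinPattern.kind (e 2)).isCoclique <;> simp
  exact ⟨fun ⟨⟨e⟩, h⟩ => ⟨e, (key e).mp h⟩, fun ⟨e, h⟩ => ⟨⟨e⟩, (key e).mpr h⟩⟩

theorem structureG2_iff : G.StructureG2 ↔ shapeG2.Fits G.twinPattern := by
  rw [Shape.fits_iff (n := 3) rfl (by decide) (pathGraph 3) (by
    simp only [pathGraph_adj]
    decide)]
  refine exists_congr fun e => ?_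
  simp [isTypeN_iff_kind, isTypeK_iff_kind, isTypeKN_iff_kind, shapeG2]

theorem structureG3_iff : G.StructureG3 ↔ shapeG3.Fits G.twinPattern := by
  rw [Shape.fits_iff (n := 4) rfl (by decide) paw (by
    simp only [paw, fromEdgeSet_adj, Set.mem_insert_iff, Set.mem_singleton_iff,
      Sym2.eq_iff]
    decide)]
  refine exists_congr fun e => ?_
  simp [isTypeN_iff_kind, isTypeK_iff_kind, isType1K_iff_kind, isType1N_iff_kind, shapeG3]
  grind

theorem structureG4_iff : G.StructureG4 ↔ shapeG4.Fits G.twinPattern := by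
  rw [Shape.fits_iff (n := 5) rfl (by decide) (cycleGraph 5) (by decide)]
  have key : ∀ e : cycleGraph 5 ≃g G.twinGraph, (∀ a : G.TwinClass, G.IsType1 a) ↔
        shapeG4.cond (List.ofFn fun i => G.twinPattern.kind (e i)) = true := by
    intro e
    rw [e.surjective.forall]
    simp [isType1_iff_kind, Fin.forall_fin_succ, shapeG4, and_assoc]
  exact ⟨fun ⟨⟨e⟩, h⟩ => ⟨e, (key e).mp h⟩, fun ⟨e, h⟩ => ⟨⟨e⟩, (key e).mpr h⟩⟩

theorem structureG5_iff : G.StructureG5 ↔ shapeG5.Fits G.twinPattern := by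
  rw [Shape.fits_iff (n := 5) rfl (by decide) cycleFiveOneChord (by
    simp only [cycleFiveOneChord, fromEdgeSet_adj, Set.mem_insert_iff, Set.mem_singleton_iff,
      Sym2.eq_iff]
    decide)]
  refine exists_congr fun e => ?_
  simp [isType1_iff_kind, isType1K_iff_kind, shapeG5, and_assoc]

theorem structureG6_iff : G.StructureG6 ↔ shapeG6.Fits G.twinPattern := by
  have hH : ∀ i j : Fin 5, cycleFiveTwoChords.Adj i j ↔ i ≠ j ∧ shapeG6.edge i j = true := by
    simp only [cycleFiveTwoChords, fromEdgeSet_adj, Set.mem_insert_iff, Set.mem_singleton_iff,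
      Sym2.eq_iff]
    decide
  rw [Shape.fits_iff (n := 5) rfl (by decide) cycleFiveTwoChords hH]
  refine exists_congr fun e => ?_
  rw [e.surjective.forall₂, e.surjective.forall₂]
  simp only [e.injective.ne_iff, e.map_adj_iff, hH, isTypeN_iff_kind, isTypeK_iff_kind,
    isType1K_iff_kind, List.ofFn_succ, Fin.forall_fin_succ]
  simp [shapeG6, Shape.edge]
  grind

theorem structureG7_iff : G.StructureG7 ↔ shapeG7.Fits G.twinPattern := by
  rw [Shape.fits_iff (n := 5) rfl (by decide) kitePendant (by
    simp only [kitePendant, fromEdgeSet_adj, Set.mem_insert_iff, Set.mem_singleton_iff,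
      Sym2.eq_iff]
    decide)]
  refine exists_congr fun e => ?_
  simp [isType1_iff_kind, isTypeK_iff_kind, isType1K_iff_kind, shapeG7, and_assoc]

theorem structureG8_iff : G.StructureG8 ↔ shapeG8.Fits G.twinPattern := by
  rw [Shape.fits_iff (n := 4) rfl (by decide) kite (by
    simp only [kite, fromEdgeSet_adj, Set.mem_insert_iff, Set.mem_singleton_iff,
      Sym2.eq_iff]
    decide)]
  refine exists_congr fun e => ?_
  simp [isType1_iff_kind, isTypeK_iff_kind, isTypeN_iff_kind, isType1K_iff_kind, shapeG8]

theorem structureG9_iff : G.StructureG9 ↔ shapeG9.Fits G.twinPattern := by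
  rw [Shape.fits_iff (n := 4) rfl (by decide) (cycleGraph 4) (by decide)]
  refine exists_congr fun e => ?_
  simp [isType1_iff_kind, isTypeK_iff_kind, shapeG9, and_assoc]

theorem structureG10_iff : G.StructureG10 ↔ shapeG10.Fits G.twinPattern := by
  rw [Shape.fits_iff (n := 5) rfl (by decide) cycleFourJoinVertex (by
    simp only [cycleFourJoinVertex, fromEdgeSet_adj, Set.mem_insert_iff, Set.mem_singleton_iff,
      Sym2.eq_iff]
    decide)]
  refine exists_congr fun e => ?_
  simp [isType1_iff_kind, isTypeK_iff_kind, isType1K_iff_kind, shapeG10, and_assoc]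

end Structures

end SimpleGraph

/-- A pattern with one of the ten shapes has a separated set of three classes, and none of four. -/
theorem TwinSearch.Shape.Fits.separated {T : Type*} {P : TwinPattern T} {s : TwinSearch.Shape}
    (hs : s ∈ TwinSearch.shapes) (h : s.Fits P) :
    (∃ S : Finset T, S.card = 3 ∧ P.Separated S) ∧
      ¬ ∃ S : Finset T, S.card = 4 ∧ P.Separated S := by
  obtain ⟨w, hw, hsurj, hcode⟩ := h
  have h7 : s.order ≤ 7 := by
    have h : TwinSearch.shapes.all (fun s => decide (s.order ≤ 7)) = true := by decide
    simpa using List.all_eq_true.mp h s hs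
  have hc := List.all_eq_true.mp (List.all_eq_true.mp TwinSearch.shapes_check s hs) _ hcode
  rw [Bool.and_eq_true, Bool.not_eq_true'] at hc
  refine ⟨TwinSearch.anySeparated_indexSets h7 hw hc.1, fun h4 => ?_⟩
  rw [TwinSearch.anySeparated_of_exists h7 hw hsurj h4] at hc
  exact Bool.noConfusion hc.2

theorem mainTheorem1 {V : Type*} [Fintype V] (G : SimpleGraph V)
    (hconn : G.Connected) (hdiam : G.diam = 2) :
    G.metricDimension + 3 = Fintype.card V ↔
      G.StructureG1 ∨ G.StructureG2 ∨ G.StructureG3 ∨ G.StructureG4 ∨ G.StructureG5 ∨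
      G.StructureG6 ∨ G.StructureG7 ∨ G.StructureG8 ∨ G.StructureG9 ∨ G.StructureG10 := by
  have : Nonempty V := hconn.nonempty
  have hshapes : (G.StructureG1 ∨ G.StructureG2 ∨ G.StructureG3 ∨ G.StructureG4 ∨ G.StructureG5 ∨
      G.StructureG6 ∨ G.StructureG7 ∨ G.StructureG8 ∨ G.StructureG9 ∨ G.StructureG10) ↔
      ∃ s ∈ TwinSearch.shapes, s.Fits G.twinPattern := by
    simp only [TwinSearch.shapes, List.mem_cons, List.not_mem_nil, or_false, exists_eq_or_imp,
      exists_eq_left, G.structureG1_iff, G.structureG2_iff, G.structureG3_iff, G.structureG4_iff,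
      G.structureG5_iff, G.structureG6_iff, G.structureG7_iff, G.structureG8_iff, G.structureG9_iff,
      G.structureG10_iff]
  rw [hshapes, SimpleGraph.metricDimension_add_three_eq_iff hconn,
    SimpleGraph.exists_isResolvingSet_iff_exists_separated G hconn hdiam,
    SimpleGraph.exists_isResolvingSet_iff_exists_separated G hconn hdiam]
  constructor
  · rintro ⟨h3, h4⟩
    obtain ⟨k, -, w, hw, hsurj, hcode⟩ := TwinSearch.exists_codeOn_mem_of_search
      (v := fun _ => G.twinClassOf (Classical.arbitrary V)) (m := 0) G.twinPattern_reduced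
      (G.twinPattern_diamTwo hconn hdiam) h3 h4 (by simp) (by simp [Set.InjOn])
      (by simp [TwinPattern.codeOn, TwinSearch.matrixCode, TwinSearch.code])
      TwinSearch.search_check
    obtain ⟨s, hs, hcode⟩ := List.mem_flatMap.mp hcode
    obtain ⟨hmem, hk⟩ := List.mem_filter.mp hs
    obtain rfl : s.order = k := by simpa using hk
    exact ⟨s, hmem, w, hw, hsurj, hcode⟩
  · rintro ⟨s, hs, h⟩
    exact h.separated hs
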